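/- **Setting.** Let $R$ be a principal ideal domain with a fixed choice of gcd's and lcm's, let $A=R[x_1,\dots,x_k]\langle y_1,\dots,y_n\rangle$ with central variables $x_i$ and noncommuting variables $y_j$, let $[X]$ be the set of monomials in the $x_i$ and $\langle Y\rangle$ the set of words in the $y_j$. Let $\Sigma=(A\otimes_{R[X]}A)^r$ be the free $A$-bimodule with basis $\varepsilon_1,\dots,\varepsilon_r$; its module monomials are the elements $ua\varepsilon_i b$ with $u\in[X]$, $a,b\in\langle Y\rangle$. Fix a monomial ordering $\le$ on the mixed monomials $uw$ ($u\in[X]$, $w\in\langle Y\rangle$) and a module ordering $\preceq$ on the module monomials, i.e. total well-orderings compatible with multiplication. A term is a coefficient in $R$ times a monomial ($0$ is allowed and smallest). $\mathrm{LT},\mathrm{LM},\mathrm{LC}$ denote leading term, monomial and coefficient in $A$, and $\mathrm{sig}(\alpha)$ is the leading term (with coefficient) of $\alpha\in\Sigma$; signatures are compared by their monomials, and $\simeq$ means equality of the monomials. Below, $t,t'$ denote terms of $A$, and $b,b'$ words in $\langle Y\rangle$. Given $f_1,\dots,f_r\in A$, let $\alpha\mapsto\overline\alpha$ be the bimodule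 homomorphism $\Sigma\to A$ with $\varepsilon_i\mapsto f_i$. The labeled module $I^{[\Sigma]}$ is the set of pairs $f^{[\alpha]}$ with $f=\overline\alpha$; syzygies are the $\alpha$ with $\overline\alpha=0$. **Reductions and bases.** $f^{[\alpha]}$ is sig-reducible by $g^{[\beta]}$ if there are $t,b$ with $\mathrm{LT}(tgb)=\mathrm{LT}(f)>\mathrm{LT}(f-tgb)$ and $\mathrm{sig}(t\beta b)\preceq\mathrm{sig}(\alpha)$, the result being $f^{[\alpha]}-tg^{[\beta]}b$; the reduction is regular if $\mathrm{sig}(t\beta b)\prec\mathrm{sig}(\alpha)$. An element $\alpha\in\Sigma$ is reducible by $H\subseteq\Sigma$ if $\mathrm{sig}(\alpha)=\mathrm{sig}(t\gamma b)$ for some $\gamma\in H$, $t$, $b$. A set $G\subseteq I^{[\Sigma]}$ is a signature Gröbner basis if every $f^{[\alpha]}\in I^{[\Sigma]}$ with $f\ne0$ is sig-reducible by (an element of) $G$; a set $H$ of syzygies is a syzygy basis if every nonzero syzygy is reducible by $H$. **Ambiguities.** The ambiguities $(a\otimes b,c\otimes d)$ of two words $p,q$, all with $apb=cqd$, are: the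 overlaps $(a\otimes1,1\otimes b)$ with $ap=qb$ and $(1\otimes a,b\otimes1)$ with $pa=bq$, where $a,b\neq1$, $|a|<|q|$, $|b|<|p|$; the inclusions $(1\otimes1,a\otimes b)$ with $p=aqb$ and $(a\otimes b,1\otimes1)$ with $apb=q$; and, for every word $m$, the external ones $(1\otimes mq,pm\otimes1)$ and $(qm\otimes1,1\otimes mp)$. If $f,g\ne0$, $\mathrm{LM}(f)=up$, $\mathrm{LM}(g)=vq$ with $u,v\in[X]$, an ambiguity of $f^{[\alpha]},g^{[\beta]}$ is $\mathfrak a=(m_1\otimes n_1,m_2\otimes n_2)=\bigl(\tfrac{\mathrm{lcm}(u,v)}{u}a\otimes b,\tfrac{\mathrm{lcm}(u,v)}{v}c\otimes d\bigr)$ with $(a\otimes b,c\otimes d)$ an ambiguity of $p,q$. Let $\ell=\mathrm{lcm}(\mathrm{LC}(f),\mathrm{LC}(g))$, $c_f=\ell/\mathrm{LC}(f)$, $c_g=\ell/\mathrm{LC}(g)$. Put $\mathrm{LM}(\mathfrak a)=\mathrm{LM}(m_1fn_1)$, $\mathrm{SIG}(\mathfrak a)=\max(\mathrm{sig}(c_fm_1\alpha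 n_1),-\mathrm{sig}(c_gm_2\beta n_2))$ (the first one in case of a tie), $\mathrm{S\text{-}Pol}(\mathfrak a)=c_fm_1f^{[\alpha]}n_1-c_gm_2g^{[\beta]}n_2$, and let a G-polynomial of $\mathfrak a$ be $cm_1f^{[\alpha]}n_1+dm_2g^{[\beta]}n_2$ with $c\,\mathrm{LC}(f)+d\,\mathrm{LC}(g)=\gcd(\mathrm{LC}(f),\mathrm{LC}(g))$ and $c,d$ chosen such that its signature is $\simeq\mathrm{SIG}(\mathfrak a)$. $\mathfrak a$ is regular if $\mathrm{sig}(m_1\alpha n_1)\not\simeq\mathrm{sig}(m_2\beta n_2)$. $\mathfrak a$ is covered by $(G,H)$ if $\mathrm{SIG}(\mathfrak a)=\mathrm{sig}(t\beta' b)+\mathrm{sig}(t'\gamma b')$ and $\mathrm{LM}(tg'b)<\mathrm{LM}(\mathfrak a)$ for some $g'^{[\beta']}\in G$, $\gamma\in H$ and some $t,t',b,b'$, where either summand may be absent (in which case no element of $G$, respectively $H$, is needed; if the first is absent, the condition on leading monomials is void). $G$ is complete if all G-polynomials of ambiguities of elements of $G$ are sig-reducible by $G$. A sig-combination of syzygies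 $\gamma_1,\gamma_2$ with $\mathrm{sig}(\gamma_i)=c_i\sigma_i$, $\sigma_i=u_ia_i\varepsilon_jb_i$ (same $j$), where one of $a_1,a_2$ is a suffix of the other and one of $b_1,b_2$ is a prefix of the other, is $cm_1\gamma_1w_1+dm_2\gamma_2w_2$, where $cc_1+dc_2=\gcd(c_1,c_2)$ and the monomials $m_1,m_2$ and words $w_1,w_2$ are such that $m_1\sigma_1w_1=m_2\sigma_2w_2=\mathrm{lcm}(u_1,u_2)\,a\,\varepsilon_j\,b$, with $a$ and $b$ the longer ones of $a_1,a_2$ and of $b_1,b_2$. $H$ is sig-complete if every sig-combination of elements of $H$ is reducible by $H$. **Algorithm.** For each ambiguity $\mathfrak a$ one G-polynomial $\mathrm{G\text{-}Pol}(\mathfrak a)$ is used. Start with $G=H=\emptyset$, $P=\{(f_i^{[\varepsilon_i]},\mathsf N)\mid 1\le i\le r\}$. While $P\neq\emptyset$: select and remove some $(p^{[\pi]},\mathrm{type})$ from $P$. If $\mathrm{type}=\mathsf S(\mathfrak a)$ with $\mathfrak a$ covered by $(G,H)$, do nothing else. Otherwise regular sig-reduce $p^{[\pi]}$ by $G$,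 until no regular sig-reduction is possible, to $p'^{[\pi']}$. If $p'=0$, add $\pi'$ to $H$ and make $H$ sig-complete by adding (iterated) sig-combinations. If $p'\neq0$, add $p'^{[\pi']}$ to $G$ and, for all $g^{[\beta]}\in G$ and all ambiguities $\mathfrak a$ of $p'^{[\pi']},g^{[\beta]}$, add $(\mathrm{G\text{-}Pol}(\mathfrak a),\mathsf G(\mathfrak a))$ and, if $\mathfrak a$ is regular, $(\mathrm{S\text{-}Pol}(\mathfrak a),\mathsf S(\mathfrak a))$ to $P$ (these may be infinitely many). An execution, finite or infinite, is *fair* if every element that is ever in $P$ (the generators, and the S- and G-polynomials of the ambiguities of elements of $G$) is eventually selected. **Theorem.** In every fair execution of the algorithm, let $G^{[\Sigma]}$ and $H$ be the sets of all elements that are ever added to the respective set. Then $G^{[\Sigma]}$ is a signature Gröbner basis and $H$ is a syzygy basis of $I^{[\Sigma]}$; in particular, if the execution terminates, the returned sets have these properties. Moreover, every generator $f_i^{[\varepsilon_i]}$ is processed; for every pair of elements of $G^{[\Sigma]}$, in one of its two orders, the G-polynomial of every ambiguity and the S-polynomial of every regular ambiguity are selected; every regular ambiguity of elements of $G^{[\Sigma]}$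 is covered after finitely many steps. In the limit, the hypotheses of the cover criterion hold: $g\neq0$ for all $g^{[\beta]}\in G^{[\Sigma]}$; $G^{[\Sigma]}$ is complete and $H$ is sig-complete; every nonzero term of $\Sigma$ is reducible by $H\cup\{\beta\mid g^{[\beta]}\in G^{[\Sigma]}\}$; and every regular ambiguity of elements of $G^{[\Sigma]}$ is covered by $(G^{[\Sigma]},H)$. -/

import Mathlib

noncomputable section

namespace SigGB

/-! ### The mixed algebra and the free bimodule -/

/-- Mixed monomials `x^comm * word`: the variables `x_1, …, x_k` are central, the variables
`y_1, …, y_n` do not commute. -/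
@[ext]
structure Mon (k n : ℕ) where
  comm : Fin k →₀ ℕ
  word : FreeMonoid (Fin n)

instance Mon.instMonoid (k n : ℕ) : Monoid (Mon k n) where
  one := ⟨0, 1⟩
  mul m m' := ⟨m.comm + m'.comm, m.word * m'.word⟩
  mul_assoc a b c := Mon.ext (add_assoc _ _ _) (mul_assoc _ _ _)
  one_mul a := Mon.ext (zero_add _) (one_mul _)
  mul_one a := Mon.ext (add_zero _) (mul_one _)

/-- The mixed algebra `A = R[x_1, …, x_k]⟨y_1, …, y_n⟩`: it is free over `R` on the mixed monomials,
which are multiplied as above. -/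
abbrev MixedAlg (R : Type*) [CommRing R] (k n : ℕ) : Type _ := MonoidAlgebra R (Mon k n)

/-- Module monomials `x^comm * left * ε_idx * right`, where `x^comm` is a commutative monomial and
`left`, `right` are words in the noncommutative variables. -/
@[ext]
structure ModMon (k n r : ℕ) where
  comm : Fin k →₀ ℕ
  left : FreeMonoid (Fin n)
  idx : Fin r
  right : FreeMonoid (Fin n)

/-- The module monomial `m μ b`, for a mixed monomial `m` and a word `b`. -/
def ModMon.act {k n r : ℕ} (m : Mon k n) (b : FreeMonoid (Fin n)) (μ : ModMon k n r) :
    ModMon k n r :=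
  ⟨m.comm + μ.comm, m.word * μ.left, μ.idx, μ.right * b⟩

/-- The free bimodule `Σ = (A ⊗_{R[X]} A)^r`: it is free over `R` on the module monomials. -/
abbrev FreeBimod (R : Type*) [CommRing R] (k n r : ℕ) : Type _ := ModMon k n r →₀ R

/-- A pair `(f, α)` of a polynomial and a module element. -/
abbrev LPair (R : Type*) [CommRing R] (k n r : ℕ) : Type _ := MixedAlg R k n × FreeBimod R k n r

section Basics

variable {R : Type*} [CommRing R] {k n r : ℕ}

/-- The basis element `ε_i`. -/
def eps (i : Fin r) : FreeBimod R k n r := Finsupp.single ⟨0, 1, i, 1⟩ 1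

/-- The bimodule homomorphism `α ↦ ᾱ` from `Σ` to `A` with `ε_i ↦ f_i`. -/
def bar (F : Fin r → MixedAlg R k n) (α : FreeBimod R k n r) : MixedAlg R k n :=
  α.sum fun μ c => MonoidAlgebra.single ⟨μ.comm, μ.left⟩ c * F μ.idx *
    MonoidAlgebra.single ⟨0, μ.right⟩ 1

/-- The labeled module: all pairs `(ᾱ, α)`. -/
def labeledModule (F : Fin r → MixedAlg R k n) : Set (LPair R k n r) := {p | p.1 = bar F p.2}

/-- The syzygies: all `α` with `ᾱ = 0`. -/
def syzygies (F : Fin r → MixedAlg R k n) : Set (FreeBimod R k n r) := {α | bar F α = 0}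

/-- `t f b` for the term `t = c m` (which is zero for `c = 0`) and the word `b`. -/
def polyMul (c : R) (m : Mon k n) (b : FreeMonoid (Fin n)) (f : MixedAlg R k n) : MixedAlg R k n :=
  MonoidAlgebra.single m c * f * MonoidAlgebra.single ⟨0, b⟩ 1

/-- `t α b` for the term `t = c m` (which is zero for `c = 0`) and the word `b`. -/
def modMul (c : R) (m : Mon k n) (b : FreeMonoid (Fin n)) (α : FreeBimod R k n r) :
    FreeBimod R k n r :=
  c • α.mapDomain (ModMon.act m b)

/-- `t f^[α] b` for the term `t = c m` and the word `b`. -/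
def pairMul (c : R) (m : Mon k n) (b : FreeMonoid (Fin n)) (p : LPair R k n r) : LPair R k n r :=
  (polyMul c m b p.1, modMul c m b p.2)

end Basics

/-! ### Orderings, leading terms, signatures -/

/-- The given linear order on the mixed monomials is a monomial ordering. -/
structure IsMonomialOrdering (k n : ℕ) [LinearOrder (Mon k n)] : Prop where
  mul_le_mul : ∀ a b m m' : Mon k n, m ≤ m' → a * m * b ≤ a * m' * b
  wellFounded : WellFoundedLT (Mon k n)

/-- The given linear order on the module monomials is a module ordering. -/
structure IsModuleOrdering (k n r : ℕ) [LinearOrder (ModMon k n r)] : Prop where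
  act_le_act : ∀ (m : Mon k n) (b : FreeMonoid (Fin n)) (μ ν : ModMon k n r),
    μ ≤ ν → ModMon.act m b μ ≤ ModMon.act m b ν
  wellFounded : WellFoundedLT (ModMon k n r)

section Leading

variable {R : Type*} [CommRing R] {k n r : ℕ}

/-- The leading monomial; `⊥` is the monomial `0`, smaller than all others. -/
def LM [LinearOrder (Mon k n)] (f : MixedAlg R k n) : WithBot (Mon k n) := f.coeff.support.max

/-- The leading coefficient (`0` for `f = 0`). -/
def LC [LinearOrder (Mon k n)] (f : MixedAlg R k n) : R := (LM f).recBotCoe 0 fun m => f.coeff m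

/-- The leading term (`0` for `f = 0`). -/
def LT [LinearOrder (Mon k n)] (f : MixedAlg R k n) : MixedAlg R k n :=
  (LM f).recBotCoe 0 fun m => MonoidAlgebra.single m (f.coeff m)

/-- The monomial of the signature of `α` (`⊥` for `α = 0`). On signatures, `≃`, `⪯` and `≺` are
`=`, `≤` and `<` of these monomials. -/
def sigMon [LinearOrder (ModMon k n r)] (α : FreeBimod R k n r) : WithBot (ModMon k n r) :=
  α.support.max

/-- The coefficient of the signature of `α` (`0` for `α = 0`). -/
def sigCoeff [LinearOrder (ModMon k n r)] (α : FreeBimod R k n r) : R :=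
  (sigMon α).recBotCoe 0 fun μ => α μ

/-- The signature of `α`: its largest term, with its coefficient (`0` for `α = 0`). -/
def sig [LinearOrder (ModMon k n r)] (α : FreeBimod R k n r) : FreeBimod R k n r :=
  (sigMon α).recBotCoe 0 fun μ => Finsupp.single μ (α μ)

end Leading

/-! ### Sig-reductions, signature Gröbner bases, syzygy bases -/

section Reduction

variable {R : Type*} [CommRing R] {k n r : ℕ} [LinearOrder (Mon k n)] [LinearOrder (ModMon k n r)]

/-- `h` is the result of a (top) sig-reduction of `p` by `q`. -/
def SigReduction (p q h : LPair R k n r) : Prop :=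
  ∃ (c : R) (m : Mon k n) (b : FreeMonoid (Fin n)),
    h = p - pairMul c m b q ∧ LT (polyMul c m b q.1) = LT p.1 ∧ LM h.1 < LM p.1 ∧
      sigMon (modMul c m b q.2) ≤ sigMon p.2

/-- `h` is the result of a regular sig-reduction of `p` by `q`. -/
def RegSigReduction (p q h : LPair R k n r) : Prop :=
  ∃ (c : R) (m : Mon k n) (b : FreeMonoid (Fin n)),
    h = p - pairMul c m b q ∧ LT (polyMul c m b q.1) = LT p.1 ∧ LM h.1 < LM p.1 ∧
      sigMon (modMul c m b q.2) < sigMon p.2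

/-- `p` is sig-reducible by the set `G`. -/
def SigReducible (G : Set (LPair R k n r)) (p : LPair R k n r) : Prop :=
  ∃ q ∈ G, ∃ h, SigReduction p q h

/-- `p'` is a result of regular sig-reducing `p` by `G`, as far as possible. -/
def RegSigReducesTo (G : Set (LPair R k n r)) (p p' : LPair R k n r) : Prop :=
  Relation.ReflTransGen (fun u v => ∃ q ∈ G, RegSigReduction u q v) p p' ∧
    ¬ ∃ q ∈ G, ∃ h, RegSigReduction p' q h

/-- The module element `α` is (top) reducible by the set `H`. -/
def ModReducible (H : Set (FreeBimod R k n r)) (α : FreeBimod R k n r) : Prop :=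
  ∃ γ ∈ H, ∃ (c : R) (m : Mon k n) (b : FreeMonoid (Fin n)), sig α = sig (modMul c m b γ)

/-- `G` is a (strong) signature Gröbner basis of the labeled module of `F`. -/
def IsSigGroebnerBasis (F : Fin r → MixedAlg R k n) (G : Set (LPair R k n r)) : Prop :=
  G ⊆ labeledModule F ∧ ∀ p ∈ labeledModule F, p.1 ≠ 0 → SigReducible G p

/-- `H` is a syzygy basis of the labeled module of `F`. -/
def IsSyzygyBasis (F : Fin r → MixedAlg R k n) (H : Set (FreeBimod R k n r)) : Prop :=
  H ⊆ syzygies F ∧ ∀ α ∈ syzygies F, α ≠ 0 → ModReducible H α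

end Reduction

/-! ### Ambiguities -/

/-- `WordAmb p q a b c d` says that `(a ⊗ b, c ⊗ d, p, q)` is an ambiguity of the words `p`, `q`. -/
inductive WordAmb {n : ℕ} (p q : FreeMonoid (Fin n)) :
    FreeMonoid (Fin n) → FreeMonoid (Fin n) → FreeMonoid (Fin n) → FreeMonoid (Fin n) → Prop
  | overlap_left (a b : FreeMonoid (Fin n)) : a ≠ 1 → b ≠ 1 → a.length < q.length →
      b.length < p.length → a * p = q * b → WordAmb p q a 1 1 b
  | overlap_right (a b : FreeMonoid (Fin n)) : a ≠ 1 → b ≠ 1 → a.length < q.length →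
      b.length < p.length → p * a = b * q → WordAmb p q 1 a b 1
  | inclusion_left (a b : FreeMonoid (Fin n)) : p = a * q * b → WordAmb p q 1 1 a b
  | inclusion_right (a b : FreeMonoid (Fin n)) : a * p * b = q → WordAmb p q a b 1 1
  | external_left (m : FreeMonoid (Fin n)) : WordAmb p q 1 (m * q) (p * m) 1
  | external_right (m : FreeMonoid (Fin n)) : WordAmb p q (q * m) 1 1 (m * p)

/-- The data `(m₁ ⊗ n₁, m₂ ⊗ n₂, p, q)` of an ambiguity of the labeled polynomials `p`, `q`. -/
structure Amb (R : Type*) [CommRing R] (k n r : ℕ) where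
  m₁ : Mon k n
  n₁ : FreeMonoid (Fin n)
  m₂ : Mon k n
  n₂ : FreeMonoid (Fin n)
  p : LPair R k n r
  q : LPair R k n r

/-- The set of ambiguities of `p` and `q` (empty if one of their polynomial parts is zero).
The lcm of two commutative monomials is the pointwise maximum of the exponents. -/
def amb {R : Type*} [CommRing R] {k n r : ℕ} [LinearOrder (Mon k n)] (p q : LPair R k n r) :
    Set (Amb R k n r) :=
  {a | a.p = p ∧ a.q = q ∧ ∃ μ ν : Mon k n, LM p.1 = μ ∧ LM q.1 = ν ∧
    a.m₁.comm = (μ.comm ⊔ ν.comm) - μ.comm ∧ a.m₂.comm = (μ.comm ⊔ ν.comm) - ν.comm ∧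
    WordAmb μ.word ν.word a.m₁.word a.n₁ a.m₂.word a.n₂}

section Ambiguities

variable {R : Type*} [CommRing R] [IsDomain R] [GCDMonoid R] {k n r : ℕ}
  [LinearOrder (Mon k n)] [LinearOrder (ModMon k n r)]

/-- The leading monomial of an ambiguity. -/
def Amb.lm (a : Amb R k n r) : WithBot (Mon k n) := LM (polyMul 1 a.m₁ a.n₁ a.p.1)

/-- The cofactor `lcm(LC f, LC g) / LC f`. -/
def Amb.c₁ (a : Amb R k n r) : R := Classical.choose (dvd_lcm_left (LC a.p.1) (LC a.q.1))

/-- The cofactor `lcm(LC f, LC g) / LC g`. -/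
def Amb.c₂ (a : Amb R k n r) : R := Classical.choose (dvd_lcm_right (LC a.p.1) (LC a.q.1))

/-- The signature of an ambiguity: the maximum of `sig(c₁ m₁ α n₁)` and `-sig(c₂ m₂ β n₂)`, the
first one in case of a tie. -/
def Amb.sig (a : Amb R k n r) : FreeBimod R k n r :=
  if sigMon (modMul a.c₂ a.m₂ a.n₂ a.q.2) ≤ sigMon (modMul a.c₁ a.m₁ a.n₁ a.p.2) then
    SigGB.sig (modMul a.c₁ a.m₁ a.n₁ a.p.2)
  else - SigGB.sig (modMul a.c₂ a.m₂ a.n₂ a.q.2)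

/-- An ambiguity is regular if the two signatures `sig(m₁ α n₁)`, `sig(m₂ β n₂)` have different
monomials. -/
def Amb.IsRegular (a : Amb R k n r) : Prop :=
  sigMon (modMul 1 a.m₁ a.n₁ a.p.2) ≠ sigMon (modMul 1 a.m₂ a.n₂ a.q.2)

/-- The S-polynomial of an ambiguity. -/
def Amb.sPol (a : Amb R k n r) : LPair R k n r :=
  pairMul a.c₁ a.m₁ a.n₁ a.p - pairMul a.c₂ a.m₂ a.n₂ a.q

/-- `h` is a G-polynomial of the ambiguity `a`: it is formed with Bézout coefficients `c`, `d` for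
which the signatures of the two summands do not cancel. -/
def Amb.IsGPol (a : Amb R k n r) (h : LPair R k n r) : Prop :=
  ∃ c d : R, c * LC a.p.1 + d * LC a.q.1 = gcd (LC a.p.1) (LC a.q.1) ∧
    h = pairMul c a.m₁ a.n₁ a.p + pairMul d a.m₂ a.n₂ a.q ∧ sigMon h.2 = sigMon a.sig

/-- `G` is complete: the G-polynomials of all ambiguities of `G` are sig-reducible by `G`. -/
def IsComplete (G : Set (LPair R k n r)) : Prop :=
  ∀ p ∈ G, ∀ q ∈ G, ∀ a ∈ amb p q, ∀ h, a.IsGPol h → SigReducible G h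

/-- The ambiguity `a` is covered by `(G, H)`. Inserting `0` into `G` and `H` expresses that either
summand may be absent, also when `G` or `H` is empty. -/
def Amb.IsCovered (a : Amb R k n r) (G : Set (LPair R k n r)) (H : Set (FreeBimod R k n r)) :
    Prop :=
  ∃ p ∈ insert 0 G, ∃ γ ∈ insert 0 H, ∃ (c c' : R) (m m' : Mon k n) (b b' : FreeMonoid (Fin n)),
    a.sig = SigGB.sig (modMul c m b p.2) + SigGB.sig (modMul c' m' b' γ) ∧
      LM (polyMul c m b p.1) < a.lm

end Ambiguities

/-! ### Sig-combinations -/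

/-- `τ` is the least common multiple of the module monomials `σ₁`, `σ₂` (which need not exist). -/
def ModMon.IsLcm {k n r : ℕ} (σ₁ σ₂ τ : ModMon k n r) : Prop :=
  σ₁.idx = σ₂.idx ∧ τ.idx = σ₁.idx ∧ τ.comm = σ₁.comm ⊔ σ₂.comm ∧
    (((∃ w, σ₂.left = w * σ₁.left) ∧ τ.left = σ₂.left) ∨
      ((∃ w, σ₁.left = w * σ₂.left) ∧ τ.left = σ₁.left)) ∧
    (((∃ w, σ₂.right = σ₁.right * w) ∧ τ.right = σ₂.right) ∨
      ((∃ w, σ₁.right = σ₂.right * w) ∧ τ.right = σ₁.right))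

section SigCombinations

variable {R : Type*} [CommRing R] [IsDomain R] [GCDMonoid R] {k n r : ℕ}
  [LinearOrder (ModMon k n r)]

/-- `δ` is a sig-combination of `γ₁` and `γ₂`. -/
def IsSigComb (γ₁ γ₂ δ : FreeBimod R k n r) : Prop :=
  ∃ (σ₁ σ₂ τ : ModMon k n r) (m₁ m₂ : Mon k n) (b₁ b₂ : FreeMonoid (Fin n)) (c d : R),
    sigMon γ₁ = σ₁ ∧ sigMon γ₂ = σ₂ ∧ ModMon.IsLcm σ₁ σ₂ τ ∧
    τ = ModMon.act m₁ b₁ σ₁ ∧ τ = ModMon.act m₂ b₂ σ₂ ∧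
    c * sigCoeff γ₁ + d * sigCoeff γ₂ = gcd (sigCoeff γ₁) (sigCoeff γ₂) ∧
    δ = modMul c m₁ b₁ γ₁ + modMul d m₂ b₂ γ₂

/-- `H` is sig-complete: all sig-combinations of elements of `H` are reducible by `H`. -/
def IsSigComplete (H : Set (FreeBimod R k n r)) : Prop :=
  ∀ γ₁ ∈ H, ∀ γ₂ ∈ H, ∀ δ, IsSigComb γ₁ γ₂ δ → ModReducible H δ

/-- The elements obtained from `H` by iterated sig-combinations. -/
inductive SigCombClosure (H : Set (FreeBimod R k n r)) : FreeBimod R k n r → Prop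
  | base (γ : FreeBimod R k n r) : γ ∈ H → SigCombClosure H γ
  | comb (γ₁ γ₂ δ : FreeBimod R k n r) : SigCombClosure H γ₁ → SigCombClosure H γ₂ →
      IsSigComb γ₁ γ₂ δ → SigCombClosure H δ

/-- `H'` arises by making `H` sig-complete: iterated sig-combinations are added until the set is
sig-complete. -/
def IsSigCompletion (H H' : Set (FreeBimod R k n r)) : Prop :=
  H ⊆ H' ∧ (∀ γ ∈ H', SigCombClosure H γ) ∧ IsSigComplete H'

end SigCombinations

/-! ### The algorithm -/

/-- The type of an element of the queue: `N` for an input polynomial, `S a` and `G a` for the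
S-polynomial and the G-polynomial of the ambiguity `a`. -/
inductive ItemType (R : Type*) [CommRing R] (k n r : ℕ) where
  | N : ItemType R k n r
  | S (a : Amb R k n r) : ItemType R k n r
  | G (a : Amb R k n r) : ItemType R k n r

/-- An element `(p^[π], type)` of the queue. -/
abbrev Item (R : Type*) [CommRing R] (k n r : ℕ) : Type _ := LPair R k n r × ItemType R k n r

/-- The values of the variables `G`, `H`, `P` of the algorithm. -/
structure State (R : Type*) [CommRing R] (k n r : ℕ) where
  G : Set (LPair R k n r)
  H : Set (FreeBimod R k n r)
  P : Set (Item R k n r)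

section Algorithm

variable {R : Type*} [CommRing R] {k n r : ℕ}

/-- The queue element `(f_i^[ε_i], N)`. -/
def inputItem (F : Fin r → MixedAlg R k n) (i : Fin r) : Item R k n r :=
  ((F i, eps i), ItemType.N)

/-- The initial values. -/
def initState (F : Fin r → MixedAlg R k n) : State R k n r := ⟨∅, ∅, Set.range (inputItem F)⟩

variable [IsDomain R] [GCDMonoid R] [LinearOrder (Mon k n)] [LinearOrder (ModMon k n r)]

/-- The pairs that are added to the queue after `p'` has been added to the basis, which is now `G`;
`gPol a` is the G-polynomial of `a`. -/
def newItems (gPol : Amb R k n r → LPair R k n r) (G : Set (LPair R k n r)) (p' : LPair R k n r) :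
    Set (Item R k n r) :=
  {y | ∃ g ∈ G, ∃ a ∈ amb p' g,
    (a.IsRegular ∧ y = (a.sPol, ItemType.S a)) ∨ y = (gPol a, ItemType.G a)}

/-- The selected element `x` is skipped: its type is `S a` with `a` already covered. -/
def Skipped (s : State R k n r) (x : Item R k n r) : Prop :=
  ∃ a, x.2 = ItemType.S a ∧ a.IsCovered s.G s.H

/-- One run through the main loop, from `s` to `s'`, in which `x` is selected. -/
def Step (gPol : Amb R k n r → LPair R k n r) (s : State R k n r) (x : Item R k n r)
    (s' : State R k n r) : Prop :=
  x ∈ s.P ∧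
    ((Skipped s x ∧ s'.G = s.G ∧ s'.H = s.H ∧ s'.P = s.P \ {x}) ∨
      (¬ Skipped s x ∧ ∃ p', RegSigReducesTo s.G x.1 p' ∧
        ((p'.1 = 0 ∧ s'.G = s.G ∧ IsSigCompletion (insert p'.2 s.H) s'.H ∧ s'.P = s.P \ {x}) ∨
          (p'.1 ≠ 0 ∧ s'.G = insert p' s.G ∧ s'.H = s.H ∧
            s'.P = (s.P \ {x}) ∪ newItems gPol s'.G p'))))

/-- An execution of the algorithm on the input `F`. All choices are arbitrary: the selection from
the queue, the regular sig-reductions, the sig-combinations, and the Bézout coefficients in the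
G-polynomials. If the queue is empty, then the algorithm stops; formally, its state then stays
the same for ever. -/
structure Run (F : Fin r → MixedAlg R k n) where
  /-- the G-polynomial that is used for each ambiguity -/
  gPol : Amb R k n r → LPair R k n r
  isGPol : ∀ p ∈ labeledModule F, ∀ q ∈ labeledModule F, ∀ a ∈ amb p q, a.IsGPol (gPol a)
  /-- the state before the `j`-th run through the loop -/
  state : ℕ → State R k n r
  /-- the element selected in the `j`-th run through the loop, if there is one -/
  sel : ℕ → Option (Item R k n r)
  state_zero : state 0 = initState F
  step : ∀ j, (∃ x, sel j = some x ∧ Step gPol (state j) x (state (j + 1))) ∨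
    (sel j = none ∧ (state j).P = ∅ ∧ state (j + 1) = state j)

variable {F : Fin r → MixedAlg R k n}

/-- The run is fair: every element of the queue (the input polynomials, and the S- and
G-polynomials of the ambiguities of the basis) is eventually selected. -/
def Run.IsFair (ρ : Run F) : Prop :=
  ∀ j, ∀ x ∈ (ρ.state j).P, ∃ l, ρ.sel l = some x

/-- The set of labeled polynomials that the run enumerates. -/
def Run.basis (ρ : Run F) : Set (LPair R k n r) := ⋃ j, (ρ.state j).G

/-- The set of syzygies that the run enumerates. -/
def Run.syz (ρ : Run F) : Set (FreeBimod R k n r) := ⋃ j, (ρ.state j).H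

end Algorithm

end SigGB

end

noncomputable section

namespace SigGB

/-! ### Leading elements of finitely supported functions -/

section Finsupp

variable {X Y R : Type*} [LinearOrder X] [LinearOrder Y]

/-! The core is the cover criterion `isSigGroebnerBasis_and_isSyzygyBasis`, an induction along the
well-ordering of signature monomials `μ`. Fix a coefficient `e`. The terms `ε_i` are reached by `G`
or `H`, so `e μ` splits into a term `d μ` reached by `H` and the signature of a multiple of some `g`
in `G` (or of zero). Choose a splitting in which the leading monomial of that multiple is minimal.
Then its leading term is not the leading term of any element of signature below `μ`
(`exists_irreducible_representation`). Otherwise, by induction, a multiple of some `q` in `G` of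
smaller signature shares this leading term. The two multiples come from a regular ambiguity of `g`
and `q` (`exists_mem_amb`), and a multiple of its cover yields a splitting with smaller leading
monomial (`exists_smaller_of_isCovered`). Sig-completeness enters because the new `H`-part has to be
added to the old one (`IsSigTerm.add`).

Now add to the minimal multiple a syzygy with term `d μ`, and compare the result `x` with a labeled
polynomial `f` of signature `e μ` (`sigReducible_of_irreducible_representation`). The difference has
smaller signature. If `f` vanishes, so does `x`, which forces `e = d`: the signature is reached by
`H`. Otherwise `x` cannot have the larger leading monomial; if `f` has it, a reducer of `f - x`
reduces `f`; and if they agree, the leading term of `f` is that of a multiple of `g`, or a sum of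
two leading terms, which a G-polynomial merges into one (`exists_LT_eq_of_gPol`).

For the algorithm, regular reduction preserves signatures and never raises leading monomials. Hence
a processed S-polynomial leaves its ambiguity covered (`Run.sel_sPol`), a processed G-polynomial is
sig-reducible (`Run.sel_gPol`), and a processed generator supplies `ε_i` (`Run.sel_input`). Each
requirement involves finitely many elements and survives enlargement of the sets, so fairness
carries it to the unions. Pairs are queued in one order only: covers are transported by
`Amb.IsCovered.flip`, and the criterion asks for G-polynomials in one order only. -/

theorem max_support_le_iff [Zero R] {α : X →₀ R} {μ : X} :
    α.support.max ≤ (μ : WithBot X) ↔ ∀ ν, μ < ν → α ν = 0 := by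
  rw [Finset.max_le_iff]
  constructor
  · intro h ν hν
    by_contra hne
    exact absurd (WithBot.coe_le_coe.1 (h ν (by simpa using hne))) (not_le.2 hν)
  · intro h ν hν
    rw [WithBot.coe_le_coe]
    by_contra hlt
    exact (Finsupp.mem_support_iff.1 hν) (h ν (not_le.1 hlt))

theorem max_support_eq_iff [Zero R] {α : X →₀ R} {μ : X} :
    α.support.max = (μ : WithBot X) ↔ α μ ≠ 0 ∧ α.support.max ≤ (μ : WithBot X) := by
  constructor
  · intro h
    exact ⟨by simpa using Finset.mem_of_max h, h.le⟩
  · rintro ⟨h, h'⟩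
    exact le_antisymm h' (Finset.le_max (by simpa using h))

theorem max_support_lt_iff [Zero R] {α : X →₀ R} {μ : X} :
    α.support.max < (μ : WithBot X) ↔ α μ = 0 ∧ α.support.max ≤ (μ : WithBot X) := by
  rw [lt_iff_le_and_ne, and_comm, Ne, max_support_eq_iff]
  tauto

theorem max_support_eq_bot_iff [Zero R] {α : X →₀ R} : α.support.max = ⊥ ↔ α = 0 :=
  Finset.max_eq_bot.trans Finsupp.support_eq_empty

/-- An injective order-preserving map cannot merge or reorder terms, and a nonzero scalar of a
domain kills none. Multiplication by a term has this shape both in the algebra and in the bimodule,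
so this one fact serves leading monomials and signatures. -/
theorem max_support_smul_mapDomain [CommRing R] [IsDomain R] {φ : X → Y} (hφ : StrictMono φ)
    {c : R} (hc : c ≠ 0) (α : X →₀ R) :
    (c • α.mapDomain φ).support.max = α.support.max.map φ := by
  rcases h : α.support.max with _ | μ
  · have : α = 0 := max_support_eq_bot_iff.1 h
    subst this
    simp
    rfl
  · rw [WithBot.some_eq_coe] at h
    rw [WithBot.some_eq_coe, WithBot.map_coe, max_support_eq_iff, max_support_le_iff]
    rw [max_support_eq_iff, max_support_le_iff] at h
    refine ⟨?_, fun ν hν => ?_⟩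
    · simpa [Finsupp.mapDomain_apply hφ.injective, hc] using h.1
    · by_cases hr : ν ∈ Set.range φ
      · obtain ⟨x, rfl⟩ := hr
        simp [Finsupp.mapDomain_apply hφ.injective, h.2 x (hφ.lt_iff_lt.1 hν)]
      · simp [Finsupp.mapDomain_of_notMem_range _ _ hr]

theorem max_support_add_le [AddZeroClass R] (α β : X →₀ R) :
    (α + β).support.max ≤ max α.support.max β.support.max := by
  classical
  rw [Finset.max_le_iff]
  intro x hx
  rcases Finset.mem_union.1 (Finsupp.support_add hx) with h | h
  · exact le_max_of_le_left (Finset.le_max h)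
  · exact le_max_of_le_right (Finset.le_max h)

theorem max_support_neg [AddGroup R] (α : X →₀ R) : (-α).support.max = α.support.max := by
  rw [Finsupp.support_neg]

theorem max_support_sub_le [AddGroup R] (α β : X →₀ R) :
    (α - β).support.max ≤ max α.support.max β.support.max := by
  rw [sub_eq_add_neg, ← max_support_neg β]
  exact max_support_add_le _ _

theorem max_support_sub_lt [AddGroup R] {α β : X →₀ R} {μ : X}
    (hα : α.support.max ≤ (μ : WithBot X)) (hβ : β.support.max ≤ (μ : WithBot X))
    (h : α μ = β μ) : (α - β).support.max < (μ : WithBot X) :=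
  max_support_lt_iff.2 ⟨by simp [h], (max_support_sub_le _ _).trans (max_le hα hβ)⟩

end Finsupp

/-! ### Multiplication by terms -/

section Multiplication

variable {R : Type*} [CommRing R] {k n r : ℕ}

@[simp] theorem Mon.comm_mul (a b : Mon k n) : (a * b).comm = a.comm + b.comm := rfl

@[simp] theorem Mon.word_mul (a b : Mon k n) : (a * b).word = a.word * b.word := rfl

@[simp] theorem Mon.comm_one : (1 : Mon k n).comm = 0 := rfl

@[simp] theorem Mon.word_one : (1 : Mon k n).word = 1 := rfl

theorem ModMon.act_injective (m : Mon k n) (b : FreeMonoid (Fin n)) :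
    Function.Injective (ModMon.act m b : ModMon k n r → ModMon k n r) := by
  rintro ⟨u, a, i, d⟩ ⟨u', a', i', d'⟩ h
  simp only [ModMon.act, ModMon.mk.injEq] at h ⊢
  obtain ⟨h1, h2, h3, h4⟩ := h
  exact ⟨add_left_cancel h1, mul_left_cancel h2, h3, mul_right_cancel h4⟩

theorem ModMon.act_act (m m' : Mon k n) (b b' : FreeMonoid (Fin n)) (μ : ModMon k n r) :
    ModMon.act m b (ModMon.act m' b' μ) = ModMon.act (m * m') (b' * b) μ := by
  simp [ModMon.act, add_assoc, mul_assoc]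

theorem ModMon.act_one (μ : ModMon k n r) : ModMon.act 1 1 μ = μ := by
  simp [ModMon.act]

theorem Mon.mul_mul_injective (m : Mon k n) (b : FreeMonoid (Fin n)) :
    Function.Injective (fun x : Mon k n => m * x * ⟨0, b⟩) := by
  rintro ⟨u, a⟩ ⟨u', a'⟩ h
  rw [Mon.ext_iff] at h
  simp only [Mon.comm_mul, Mon.word_mul, add_zero] at h
  exact Mon.ext (add_left_cancel h.1) (mul_left_cancel (mul_right_cancel h.2))

/-- Puts two-sided multiplication in the algebra into the same form as `modMul`, a scalar times a
relabeling of monomials. -/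
theorem coeff_polyMul (c : R) (m : Mon k n) (b : FreeMonoid (Fin n)) (f : MixedAlg R k n) :
    (polyMul c m b f).coeff = c • f.coeff.mapDomain (fun x => m * x * ⟨0, b⟩) := by
  induction f using MonoidAlgebra.induction_linear with
  | zero => simp [polyMul]
  | add f g hf hg =>
    have : polyMul c m b (f + g) = polyMul c m b f + polyMul c m b g := by
      simp [polyMul, mul_add, add_mul]
    rw [this, MonoidAlgebra.coeff_add, hf, hg, MonoidAlgebra.coeff_add, Finsupp.mapDomain_add,
      smul_add]
  | single x d =>
    simp [polyMul, MonoidAlgebra.single_mul_single, MonoidAlgebra.coeff_single,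
      Finsupp.mapDomain_single]

theorem polyMul_add (c : R) (m : Mon k n) (b : FreeMonoid (Fin n)) (f g : MixedAlg R k n) :
    polyMul c m b (f + g) = polyMul c m b f + polyMul c m b g := by
  simp [polyMul, mul_add, add_mul]

theorem polyMul_polyMul (c c' : R) (m m' : Mon k n) (b b' : FreeMonoid (Fin n))
    (f : MixedAlg R k n) :
    polyMul c m b (polyMul c' m' b' f) = polyMul (c * c') (m * m') (b' * b) f := by
  have h1 : (MonoidAlgebra.single (m * m') (c * c') : MixedAlg R k n) =
      MonoidAlgebra.single m c * MonoidAlgebra.single m' c' := by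
    rw [MonoidAlgebra.single_mul_single]
  have h2 : (MonoidAlgebra.single ⟨0, b' * b⟩ 1 : MixedAlg R k n) =
      MonoidAlgebra.single ⟨0, b'⟩ 1 * MonoidAlgebra.single ⟨0, b⟩ 1 := by
    rw [MonoidAlgebra.single_mul_single, mul_one]
    congr 1
  simp only [polyMul, h1, h2, mul_assoc]

theorem modMul_add (c : R) (m : Mon k n) (b : FreeMonoid (Fin n)) (α β : FreeBimod R k n r) :
    modMul c m b (α + β) = modMul c m b α + modMul c m b β := by
  simp [modMul, Finsupp.mapDomain_add]

theorem modMul_single (c d : R) (m : Mon k n) (b : FreeMonoid (Fin n)) (μ : ModMon k n r) :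
    modMul c m b (Finsupp.single μ d) = Finsupp.single (ModMon.act m b μ) (c * d) := by
  simp [modMul, Finsupp.mapDomain_single]

@[simp] theorem modMul_zero (c : R) (m : Mon k n) (b : FreeMonoid (Fin n)) :
    modMul c m b (0 : FreeBimod R k n r) = 0 := by
  simp [modMul]

@[simp] theorem zero_modMul (m : Mon k n) (b : FreeMonoid (Fin n)) (α : FreeBimod R k n r) :
    modMul 0 m b α = 0 := by
  simp [modMul]

@[simp] theorem zero_polyMul (m : Mon k n) (b : FreeMonoid (Fin n)) (f : MixedAlg R k n) :
    polyMul 0 m b f = 0 := by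
  simp [polyMul]

@[simp] theorem polyMul_zero (c : R) (m : Mon k n) (b : FreeMonoid (Fin n)) :
    polyMul c m b (0 : MixedAlg R k n) = 0 := by
  simp [polyMul]

theorem modMul_modMul (c c' : R) (m m' : Mon k n) (b b' : FreeMonoid (Fin n))
    (α : FreeBimod R k n r) :
    modMul c m b (modMul c' m' b' α) = modMul (c * c') (m * m') (b' * b) α := by
  rw [modMul, modMul, modMul, Finsupp.mapDomain_smul, ← Finsupp.mapDomain_comp, smul_smul]
  congr 2
  funext μ
  exact ModMon.act_act _ _ _ _ _

theorem modMul_apply (c : R) (m : Mon k n) (b : FreeMonoid (Fin n)) (α : FreeBimod R k n r)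
    (μ : ModMon k n r) : modMul c m b α (ModMon.act m b μ) = c * α μ := by
  simp [modMul, Finsupp.mapDomain_apply (ModMon.act_injective m b)]

theorem coeff_polyMul_apply (c : R) (m : Mon k n) (b : FreeMonoid (Fin n)) (f : MixedAlg R k n)
    (x : Mon k n) : (polyMul c m b f).coeff (m * x * ⟨0, b⟩) = c * f.coeff x := by
  rw [coeff_polyMul, Finsupp.smul_apply,
    Finsupp.mapDomain_apply (f := fun x : Mon k n => m * x * ⟨0, b⟩) (Mon.mul_mul_injective m b),
    smul_eq_mul]

@[simp] theorem one_modMul (α : FreeBimod R k n r) : modMul 1 1 1 α = α := by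
  have : (ModMon.act 1 1 : ModMon k n r → ModMon k n r) = id := funext ModMon.act_one
  simp [modMul, this]

@[simp] theorem one_polyMul (f : MixedAlg R k n) : polyMul 1 1 1 f = f := by
  have h : (MonoidAlgebra.single ⟨0, 1⟩ 1 : MixedAlg R k n) = 1 := rfl
  have h' : (MonoidAlgebra.single 1 1 : MixedAlg R k n) = 1 := rfl
  simp [polyMul, h, h']

/-! ### The homomorphism to the algebra -/

variable (F : Fin r → MixedAlg R k n)

theorem bar_single (μ : ModMon k n r) (c : R) :
    bar F (Finsupp.single μ c) = polyMul c ⟨μ.comm, μ.left⟩ μ.right (F μ.idx) := by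
  simp [bar, polyMul]

theorem bar_zero : bar F 0 = 0 := by simp [bar]

theorem bar_add (α β : FreeBimod R k n r) : bar F (α + β) = bar F α + bar F β := by
  unfold bar
  refine Finsupp.sum_add_index' (fun μ => by simp) fun μ c d => ?_
  simp [MonoidAlgebra.single_add, add_mul]

theorem bar_neg (α : FreeBimod R k n r) : bar F (-α) = -bar F α := by
  rw [eq_neg_iff_add_eq_zero, ← bar_add, neg_add_cancel, bar_zero]

theorem bar_sub (α β : FreeBimod R k n r) : bar F (α - β) = bar F α - bar F β := by
  rw [sub_eq_add_neg, bar_add, bar_neg, sub_eq_add_neg]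

theorem bar_modMul (c : R) (m : Mon k n) (b : FreeMonoid (Fin n)) (α : FreeBimod R k n r) :
    bar F (modMul c m b α) = polyMul c m b (bar F α) := by
  induction α using Finsupp.induction_linear with
  | zero => simp [bar_zero]
  | add α β hα hβ => rw [modMul_add, bar_add, hα, hβ, bar_add, polyMul_add]
  | single μ d =>
    rw [modMul_single, bar_single, bar_single, polyMul_polyMul]
    rfl

theorem bar_eps (i : Fin r) : bar F (eps i) = F i := by
  rw [eps, bar_single]
  exact one_polyMul _

variable {F}

theorem pairMul_mem_labeledModule (c : R) (m : Mon k n) (b : FreeMonoid (Fin n))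
    {p : LPair R k n r} (hp : p ∈ labeledModule F) : pairMul c m b p ∈ labeledModule F := by
  change polyMul c m b p.1 = bar F (modMul c m b p.2)
  rw [bar_modMul, show p.1 = bar F p.2 from hp]

theorem add_mem_labeledModule {p q : LPair R k n r} (hp : p ∈ labeledModule F)
    (hq : q ∈ labeledModule F) : p + q ∈ labeledModule F := by
  change p.1 + q.1 = bar F (p.2 + q.2)
  rw [bar_add, show p.1 = bar F p.2 from hp, show q.1 = bar F q.2 from hq]

theorem sub_mem_labeledModule {p q : LPair R k n r} (hp : p ∈ labeledModule F)
    (hq : q ∈ labeledModule F) : p - q ∈ labeledModule F := by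
  change p.1 - q.1 = bar F (p.2 - q.2)
  rw [bar_sub, show p.1 = bar F p.2 from hp, show q.1 = bar F q.2 from hq]

end Multiplication

/-! ### Leading monomials and signatures of multiples -/

section Orders

variable {R : Type*} [CommRing R] {k n r : ℕ}

/-- Monomials cancel on both sides, so weak compatibility with multiplication is automatically
strict. -/
theorem IsMonomialOrdering.strictMono [LinearOrder (Mon k n)] (hA : IsMonomialOrdering k n)
    (m : Mon k n) (b : FreeMonoid (Fin n)) : StrictMono (fun x : Mon k n => m * x * ⟨0, b⟩) :=
  Monotone.strictMono_of_injective (fun x y h => hA.mul_le_mul m ⟨0, b⟩ x y h)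
    (Mon.mul_mul_injective m b)

theorem IsModuleOrdering.strictMono [LinearOrder (ModMon k n r)] (hM : IsModuleOrdering k n r)
    (m : Mon k n) (b : FreeMonoid (Fin n)) :
    StrictMono (ModMon.act m b : ModMon k n r → ModMon k n r) :=
  Monotone.strictMono_of_injective (fun x y h => hM.act_le_act m b x y h)
    (ModMon.act_injective m b)

section Poly

variable [LinearOrder (Mon k n)]

theorem LM_eq_bot_iff {f : MixedAlg R k n} : LM f = ⊥ ↔ f = 0 := by
  rw [LM, max_support_eq_bot_iff, MonoidAlgebra.coeff_eq_zero]

@[simp] theorem LM_zero : LM (0 : MixedAlg R k n) = ⊥ := LM_eq_bot_iff.2 rfl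

theorem exists_LM_eq {f : MixedAlg R k n} (hf : f ≠ 0) : ∃ μ : Mon k n, LM f = μ := by
  obtain ⟨μ, hμ⟩ := WithBot.ne_bot_iff_exists.1 (fun h => hf (LM_eq_bot_iff.1 h))
  exact ⟨μ, hμ.symm⟩

theorem LC_of_LM_eq {f : MixedAlg R k n} {μ : Mon k n} (h : LM f = μ) : LC f = f.coeff μ := by
  simp [LC, h]

theorem LT_of_LM_eq {f : MixedAlg R k n} {μ : Mon k n} (h : LM f = μ) :
    LT f = MonoidAlgebra.single μ (f.coeff μ) := by
  simp [LT, h]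

theorem LT_zero : LT (0 : MixedAlg R k n) = 0 := by simp [LT]

theorem LM_LT (f : MixedAlg R k n) : LM (LT f) = LM f := by
  by_cases hf : f = 0
  · simp [hf, LT_zero]
  · obtain ⟨μ, hμ⟩ := exists_LM_eq hf
    rw [LT_of_LM_eq hμ, hμ]
    have := (max_support_eq_iff.1 hμ).1
    simp [LM, MonoidAlgebra.coeff_single, Finsupp.support_single, this]

theorem LT_eq_iff {f g : MixedAlg R k n} {μ : Mon k n} (hg : LM g = μ) :
    LT f = LT g ↔ LM f = μ ∧ f.coeff μ = g.coeff μ := by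
  constructor
  · intro h
    have hf : LM f = μ := by rw [← LM_LT, h, LM_LT, hg]
    refine ⟨hf, ?_⟩
    rwa [LT_of_LM_eq hf, LT_of_LM_eq hg, MonoidAlgebra.single_right_inj] at h
  · rintro ⟨hf, h⟩
    rw [LT_of_LM_eq hf, LT_of_LM_eq hg, h]

theorem LM_polyMul [IsDomain R] (hA : IsMonomialOrdering k n) {c : R} (hc : c ≠ 0) (m : Mon k n)
    (b : FreeMonoid (Fin n)) (f : MixedAlg R k n) :
    LM (polyMul c m b f) = (LM f).map fun x => m * x * ⟨0, b⟩ := by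
  rw [LM, coeff_polyMul]
  exact max_support_smul_mapDomain (hA.strictMono m b) hc _

theorem LM_polyMul_le [IsDomain R] (hA : IsMonomialOrdering k n) (c : R) (m : Mon k n)
    (b : FreeMonoid (Fin n)) (f : MixedAlg R k n) :
    LM (polyMul c m b f) ≤ (LM f).map fun x => m * x * ⟨0, b⟩ := by
  by_cases hc : c = 0
  · simp [hc]
  · exact (LM_polyMul hA hc m b f).le

theorem polyMul_ne_zero [IsDomain R] (hA : IsMonomialOrdering k n) {c : R} (hc : c ≠ 0)
    (m : Mon k n) (b : FreeMonoid (Fin n)) {f : MixedAlg R k n} (hf : f ≠ 0) :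
    polyMul c m b f ≠ 0 := by
  intro h
  rw [← LM_eq_bot_iff, LM_polyMul hA hc] at h
  exact hf (LM_eq_bot_iff.1 (WithBot.map_eq_bot_iff.1 h))

end Poly

section Module

variable [LinearOrder (ModMon k n r)]

theorem sigMon_eq_bot_iff {α : FreeBimod R k n r} : sigMon α = ⊥ ↔ α = 0 :=
  max_support_eq_bot_iff

@[simp] theorem sigMon_zero : sigMon (0 : FreeBimod R k n r) = ⊥ := sigMon_eq_bot_iff.2 rfl

theorem exists_sigMon_eq {α : FreeBimod R k n r} (hα : α ≠ 0) :
    ∃ μ : ModMon k n r, sigMon α = μ := by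
  obtain ⟨μ, hμ⟩ := WithBot.ne_bot_iff_exists.1 (fun h => hα (sigMon_eq_bot_iff.1 h))
  exact ⟨μ, hμ.symm⟩

theorem sig_of_sigMon_eq {α : FreeBimod R k n r} {μ : ModMon k n r} (h : sigMon α = μ) :
    sig α = Finsupp.single μ (α μ) := by
  simp [sig, h]

theorem sigCoeff_of_sigMon_eq {α : FreeBimod R k n r} {μ : ModMon k n r} (h : sigMon α = μ) :
    sigCoeff α = α μ := by
  simp [sigCoeff, h]

@[simp] theorem sig_zero : sig (0 : FreeBimod R k n r) = 0 := by simp [sig]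

theorem sigMon_single {μ : ModMon k n r} {c : R} (hc : c ≠ 0) :
    sigMon (Finsupp.single μ c : FreeBimod R k n r) = μ := by
  simp [sigMon, Finsupp.support_single, hc]

theorem sigMon_sig (α : FreeBimod R k n r) : sigMon (sig α) = sigMon α := by
  by_cases hα : α = 0
  · simp [hα]
  · obtain ⟨μ, hμ⟩ := exists_sigMon_eq hα
    rw [sig_of_sigMon_eq hμ, hμ, sigMon_single (max_support_eq_iff.1 hμ).1]

theorem sig_eq_single_iff {α : FreeBimod R k n r} {μ : ModMon k n r} {c : R} (hc : c ≠ 0) :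
    sig α = Finsupp.single μ c ↔ sigMon α = μ ∧ α μ = c := by
  constructor
  · intro h
    have h' : sigMon α = μ := by rw [← sigMon_sig, h, sigMon_single hc]
    refine ⟨h', ?_⟩
    rw [sig_of_sigMon_eq h'] at h
    exact Finsupp.single_injective _ h
  · rintro ⟨h, rfl⟩
    exact sig_of_sigMon_eq h

/-- The bound is weak so that a zero coefficient, for which the element vanishes, needs no separate
treatment later. -/
theorem le_and_apply_of_sig_eq_single {α : FreeBimod R k n r} {μ : ModMon k n r} {c : R}
    (h : sig α = Finsupp.single μ c) : sigMon α ≤ μ ∧ α μ = c := by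
  by_cases hc : c = 0
  · have : α = 0 := by
      rw [← sigMon_eq_bot_iff, ← sigMon_sig, h, hc, Finsupp.single_zero, sigMon_zero]
    simp [this, hc]
  · have := (sig_eq_single_iff hc).1 h
    exact ⟨this.1.le, this.2⟩

theorem sigMon_modMul [IsDomain R] (hM : IsModuleOrdering k n r) {c : R} (hc : c ≠ 0)
    (m : Mon k n) (b : FreeMonoid (Fin n)) (α : FreeBimod R k n r) :
    sigMon (modMul c m b α) = (sigMon α).map (ModMon.act m b) :=
  max_support_smul_mapDomain (hM.strictMono m b) hc _

theorem sigMon_modMul_le [IsDomain R] (hM : IsModuleOrdering k n r) (c : R)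
    (m : Mon k n) (b : FreeMonoid (Fin n)) (α : FreeBimod R k n r) :
    sigMon (modMul c m b α) ≤ (sigMon α).map (ModMon.act m b) := by
  by_cases hc : c = 0
  · simp [hc]
  · exact (sigMon_modMul hM hc m b α).le

theorem sig_modMul [IsDomain R] (hM : IsModuleOrdering k n r) (c : R)
    (m : Mon k n) (b : FreeMonoid (Fin n)) (α : FreeBimod R k n r) :
    sig (modMul c m b α) = modMul c m b (sig α) := by
  by_cases hc : c = 0
  · simp [hc]
  by_cases hα : α = 0
  · simp [hα]
  obtain ⟨μ, hμ⟩ := exists_sigMon_eq hα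
  have : sigMon (modMul c m b α) = ModMon.act m b μ := by
    rw [sigMon_modMul hM hc, hμ, WithBot.map_coe]
  rw [sig_of_sigMon_eq this, sig_of_sigMon_eq hμ, modMul_single, modMul_apply]

/-- If two signatures add up to a nonzero term, then both are multiples of its monomial. -/
theorem exists_single_of_sig_add_sig {α β : FreeBimod R k n r} {μ : ModMon k n r} {e : R}
    (he : e ≠ 0) (h : sig α + sig β = Finsupp.single μ e) :
    ∃ d, sig α = Finsupp.single μ (e - d) ∧ sig β = Finsupp.single μ d := by
  by_cases hα : α = 0
  · subst hα
    exact ⟨e, by simpa using h⟩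
  by_cases hβ : β = 0
  · subst hβ
    exact ⟨0, by simpa using h⟩
  obtain ⟨μ₁, h₁⟩ := exists_sigMon_eq hα
  obtain ⟨μ₂, h₂⟩ := exists_sigMon_eq hβ
  have n₁ := (max_support_eq_iff.1 h₁).1
  have n₂ := (max_support_eq_iff.1 h₂).1
  rw [sig_of_sigMon_eq h₁, sig_of_sigMon_eq h₂] at h ⊢
  have e₁ := DFunLike.congr_fun h μ₁
  have e₂ := DFunLike.congr_fun h μ₂
  have e₃ := DFunLike.congr_fun h μ
  simp only [Finsupp.add_apply, Finsupp.single_apply] at e₁ e₂ e₃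
  have k₁ : μ₁ = μ := by
    by_contra hne
    rcases eq_or_ne μ₂ μ₁ with h21 | h21
    · subst h21
      simp [hne, he.symm] at e₃
    · simp [Ne.symm hne, h21, n₁] at e₁
  have k₂ : μ₂ = μ := by
    by_contra hne
    subst k₁
    simp [Ne.symm hne, Ne.symm, n₂] at e₂
  subst k₁
  subst k₂
  refine ⟨β μ₂, ?_, rfl⟩
  congr 1
  simp at e₃
  rw [← e₃, add_sub_cancel_right]

end Module

end Orders

/-! ### Ambiguities of words and of labeled polynomials -/

section Words

variable {n : ℕ}

theorem WordAmb.symm {p q a b c d : FreeMonoid (Fin n)} (h : WordAmb p q a b c d) :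
    WordAmb q p c d a b := by
  cases h with
  | overlap_left _ _ ha hb ha' hb' h => exact .overlap_right _ _ hb ha hb' ha' h.symm
  | overlap_right _ _ ha hb ha' hb' h => exact .overlap_left _ _ hb ha hb' ha' h.symm
  | inclusion_left _ _ h => exact .inclusion_right _ _ h.symm
  | inclusion_right _ _ h => exact .inclusion_left _ _ h.symm
  | external_left m => exact .external_right m
  | external_right m => exact .external_left m

theorem WordAmb.mul_eq {p q a b c d : FreeMonoid (Fin n)} (h : WordAmb p q a b c d) :
    a * p * b = c * q * d := by
  cases h <;> simp_all [mul_assoc]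

theorem mul_eq_mul_cases {a b c d : FreeMonoid (Fin n)} (h : a * b = c * d) :
    (∃ s, c = a * s ∧ b = s * d) ∨ ∃ s, a = c * s ∧ d = s * b :=
  List.append_eq_append_iff.1 h

/-- The case where `q` starts first, with the common left context stripped. Either `p` ends inside
`q`, or it ends at or after the end of `q` and begins inside `q`, or it begins after `q`; these give
inclusions, overlaps and external ambiguities. -/
theorem exists_wordAmb_of_prefix {p q s b d : FreeMonoid (Fin n)} (h : s * p * b = q * d) :
    ∃ R a' b' d', WordAmb p q a' b' 1 d' ∧ s = a' ∧ b = b' * R ∧ d = d' * R := by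
  rcases mul_eq_mul_cases h with ⟨t, rfl, rfl⟩ | ⟨t, ht, rfl⟩
  · exact ⟨d, s, t, 1, .inclusion_right s t rfl, rfl, rfl, (one_mul _).symm⟩
  · rcases mul_eq_mul_cases ht with ⟨u, hu, hu'⟩ | ⟨u, rfl, rfl⟩
    · by_cases hs : s = 1
      · subst hs
        exact ⟨b, 1, 1, t, .inclusion_left 1 t (by simpa using ht), rfl, (one_mul _).symm, rfl⟩
      by_cases ht1 : t = 1
      · subst ht1
        exact ⟨b, s, 1, 1, .inclusion_right s 1 (by simpa using ht), rfl, (one_mul _).symm, rfl⟩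
      -- The common part `u` is empty: the words are adjacent, which is not an overlap but the
      -- external ambiguity with empty middle word.
      by_cases hu1 : u = 1
      · subst hu1
        rw [mul_one] at hu
        rw [one_mul] at hu'
        subst hu hu'
        exact ⟨b, q, 1, p, by simpa using WordAmb.external_right (p := p) (q := q) 1, rfl,
          (one_mul _).symm, rfl⟩
      have hpos : 0 < u.length := by
        rw [Nat.pos_iff_ne_zero, Ne, FreeMonoid.length_eq_zero]
        exact hu1
      refine ⟨b, s, 1, t, .overlap_left s t hs ht1 ?_ ?_ ht, rfl, (one_mul _).symm, rfl⟩
      · rw [hu, FreeMonoid.length_mul]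
        omega
      · rw [hu', FreeMonoid.length_mul]
        omega
    · exact ⟨b, q * u, 1, u * p, .external_right u, rfl, (one_mul _).symm, rfl⟩

/-- Two occurrences of words in a common word come from an ambiguity. -/
theorem exists_wordAmb {p q a b c d : FreeMonoid (Fin n)} (h : a * p * b = c * q * d) :
    ∃ L R a' b' c' d', WordAmb p q a' b' c' d' ∧ a = L * a' ∧ b = b' * R ∧ c = L * c' ∧
      d = d' * R := by
  rw [mul_assoc, mul_assoc] at h
  rcases mul_eq_mul_cases h with ⟨s, rfl, h'⟩ | ⟨s, rfl, h'⟩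
  · rw [← mul_assoc] at h'
    obtain ⟨R, a', b', d', h1, rfl, rfl, rfl⟩ := exists_wordAmb_of_prefix h'.symm
    exact ⟨a, R, 1, d', s, b', h1.symm, (mul_one _).symm, rfl, rfl, rfl⟩
  · rw [← mul_assoc] at h'
    obtain ⟨R, a', b', d', h1, rfl, rfl, rfl⟩ := exists_wordAmb_of_prefix h'.symm
    exact ⟨c, R, s, b', 1, d', h1, rfl, rfl, (mul_one _).symm, rfl⟩

end Words

section Amb

variable {R : Type*} [CommRing R] {k n r : ℕ} [LinearOrder (Mon k n)]

/-- The same ambiguity with the two labeled polynomials interchanged. -/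
def Amb.flip (a : Amb R k n r) : Amb R k n r := ⟨a.m₂, a.n₂, a.m₁, a.n₁, a.q, a.p⟩

theorem flip_mem_amb {p q : LPair R k n r} {a : Amb R k n r} (ha : a ∈ amb p q) :
    a.flip ∈ amb q p := by
  obtain ⟨h1, h2, μ, ν, hμ, hν, h3, h4, h5⟩ := ha
  refine ⟨h2, h1, ν, μ, hν, hμ, ?_, ?_, h5.symm⟩
  · rw [sup_comm]
    exact h4
  · rw [sup_comm]
    exact h3

theorem mul_mul_eq_of_mem_amb {p q : LPair R k n r} {a : Amb R k n r} (ha : a ∈ amb p q)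
    {μ ν : Mon k n} (hμ : LM p.1 = μ) (hν : LM q.1 = ν) :
    a.m₁ * μ * ⟨0, a.n₁⟩ = a.m₂ * ν * ⟨0, a.n₂⟩ := by
  obtain ⟨-, -, μ', ν', hμ', hν', h3, h4, h5⟩ := ha
  obtain rfl : μ = μ' := WithBot.coe_injective (hμ.symm.trans hμ')
  obtain rfl : ν = ν' := WithBot.coe_injective (hν.symm.trans hν')
  refine Mon.ext ?_ h5.mul_eq
  simp only [Mon.comm_mul, h3, h4, add_zero]
  rw [tsub_add_cancel_of_le le_sup_left, tsub_add_cancel_of_le le_sup_right]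

/-- If multiples of two labeled polynomials have the same leading monomial, then they are common
multiples of the two sides of an ambiguity. -/
theorem exists_mem_amb {p q : LPair R k n r} {μ ν : Mon k n} (hμ : LM p.1 = μ) (hν : LM q.1 = ν)
    {m₁ m₂ : Mon k n} {b₁ b₂ : FreeMonoid (Fin n)}
    (h : m₁ * μ * ⟨0, b₁⟩ = m₂ * ν * ⟨0, b₂⟩) :
    ∃ a ∈ amb p q, ∃ (m : Mon k n) (b : FreeMonoid (Fin n)), m₁ = m * a.m₁ ∧ b₁ = a.n₁ * b ∧
      m₂ = m * a.m₂ ∧ b₂ = a.n₂ * b := by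
  rw [Mon.ext_iff] at h
  simp only [Mon.comm_mul, Mon.word_mul, add_zero] at h
  obtain ⟨hc, hw⟩ := h
  obtain ⟨L, W, a', b', c', d', hamb, h1, h2, h3, h4⟩ := exists_wordAmb hw
  have hle : μ.comm ⊔ ν.comm ≤ m₁.comm + μ.comm :=
    sup_le (le_add_of_nonneg_left zero_le) (hc ▸ le_add_of_nonneg_left zero_le)
  refine ⟨⟨⟨(μ.comm ⊔ ν.comm) - μ.comm, a'⟩, b', ⟨(μ.comm ⊔ ν.comm) - ν.comm, c'⟩, d', p, q⟩,
    ⟨rfl, rfl, μ, ν, hμ, hν, rfl, rfl, hamb⟩, ⟨m₁.comm + μ.comm - (μ.comm ⊔ ν.comm), L⟩, W,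
    Mon.ext ?_ h1, h2, Mon.ext ?_ h3, h4⟩
  · refine add_right_cancel (b := μ.comm) ?_
    rw [Mon.comm_mul, add_assoc, tsub_add_cancel_of_le le_sup_left, tsub_add_cancel_of_le hle]
  · refine add_right_cancel (b := ν.comm) ?_
    rw [Mon.comm_mul, add_assoc, tsub_add_cancel_of_le le_sup_right, tsub_add_cancel_of_le hle, hc]

end Amb

/-! ### Coefficients, signatures and leading monomials of ambiguities -/

section AmbCoeff

variable {R : Type*} [CommRing R] {k n r : ℕ} [LinearOrder (Mon k n)]

theorem LC_ne_zero_of_LM_eq {f : MixedAlg R k n} {μ : Mon k n} (h : LM f = μ) : LC f ≠ 0 := by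
  rw [LC_of_LM_eq h]
  exact (max_support_eq_iff.1 h).1

theorem LC_ne_zero_of_mem_amb {p q : LPair R k n r} {a : Amb R k n r} (ha : a ∈ amb p q) :
    LC a.p.1 ≠ 0 ∧ LC a.q.1 ≠ 0 := by
  obtain ⟨rfl, rfl, μ, ν, hμ, hν, -⟩ := ha
  exact ⟨LC_ne_zero_of_LM_eq hμ, LC_ne_zero_of_LM_eq hν⟩

theorem Amb.lm_eq [IsDomain R] (hA : IsMonomialOrdering k n) {p q : LPair R k n r} {a : Amb R k n r}
    (ha : a ∈ amb p q) {μ : Mon k n} (hμ : LM p.1 = μ) :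
    a.lm = ((a.m₁ * μ * ⟨0, a.n₁⟩ : Mon k n) : WithBot (Mon k n)) := by
  obtain ⟨rfl, rfl, -⟩ := ha
  rw [Amb.lm, LM_polyMul hA one_ne_zero, hμ, WithBot.map_coe]

theorem Amb.flip_lm [IsDomain R] (hA : IsMonomialOrdering k n) {p q : LPair R k n r} {a : Amb R k n r}
    (ha : a ∈ amb p q) : a.flip.lm = a.lm := by
  obtain ⟨-, -, μ, ν, hμ, hν, -⟩ := id ha
  rw [Amb.lm_eq hA ha hμ, Amb.lm_eq hA (flip_mem_amb ha) hν, mul_mul_eq_of_mem_amb ha hμ hν]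
  rfl

section GCD

variable [GCDMonoid R]

theorem Amb.lcm_eq_mul_c₁ (a : Amb R k n r) : lcm (LC a.p.1) (LC a.q.1) = LC a.p.1 * a.c₁ :=
  Classical.choose_spec (dvd_lcm_left (LC a.p.1) (LC a.q.1))

theorem Amb.lcm_eq_mul_c₂ (a : Amb R k n r) : lcm (LC a.p.1) (LC a.q.1) = LC a.q.1 * a.c₂ :=
  Classical.choose_spec (dvd_lcm_right (LC a.p.1) (LC a.q.1))

theorem Amb.IsCovered.mono [LinearOrder (ModMon k n r)] {a : Amb R k n r} {G G' : Set (LPair R k n r)}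
    {H H' : Set (FreeBimod R k n r)} (h : a.IsCovered G H) (hG : G ⊆ G') (hH : H ⊆ H') :
    a.IsCovered G' H' := by
  obtain ⟨p, hp, γ, hγ, h⟩ := h
  exact ⟨p, Set.insert_subset_insert hG hp, γ, Set.insert_subset_insert hH hγ, h⟩

theorem Amb.c₁_ne_zero {p q : LPair R k n r} {a : Amb R k n r} (ha : a ∈ amb p q) :
    a.c₁ ≠ 0 := by
  obtain ⟨h1, h2⟩ := LC_ne_zero_of_mem_amb ha
  intro h
  have := a.lcm_eq_mul_c₁
  rw [h, mul_zero, lcm_eq_zero_iff] at this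
  tauto

theorem Amb.c₂_ne_zero {p q : LPair R k n r} {a : Amb R k n r} (ha : a ∈ amb p q) :
    a.c₂ ≠ 0 := by
  obtain ⟨h1, h2⟩ := LC_ne_zero_of_mem_amb ha
  intro h
  have := a.lcm_eq_mul_c₂
  rw [h, mul_zero, lcm_eq_zero_iff] at this
  tauto

variable [IsDomain R]

/-- The cofactors are nonzero in a domain, so they affect neither the monomials nor their
comparison. -/
theorem Amb.sigMon_sig [LinearOrder (ModMon k n r)]
    (hM : IsModuleOrdering k n r) {p q : LPair R k n r} {a : Amb R k n r}
    (ha : a ∈ amb p q) : sigMon a.sig =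
      max (sigMon (modMul 1 a.m₁ a.n₁ p.2)) (sigMon (modMul 1 a.m₂ a.n₂ q.2)) := by
  have h1 := Amb.c₁_ne_zero ha
  have h2 := Amb.c₂_ne_zero ha
  obtain ⟨rfl, rfl, -⟩ := ha
  rw [Amb.sig, sigMon_modMul hM h1, sigMon_modMul hM h2, sigMon_modMul hM one_ne_zero,
    sigMon_modMul hM one_ne_zero]
  split_ifs with h
  · rw [SigGB.sigMon_sig, sigMon_modMul hM h1, max_eq_left h]
  · rw [show sigMon (-SigGB.sig (modMul a.c₂ a.m₂ a.n₂ a.q.2)) =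
      sigMon (SigGB.sig (modMul a.c₂ a.m₂ a.n₂ a.q.2)) from max_support_neg _,
      SigGB.sigMon_sig, sigMon_modMul hM h2, max_eq_right (not_le.1 h).le]

/-- The signature of a regular ambiguity changes by a unit when its sides are interchanged. -/
theorem Amb.exists_flip_sig_eq [LinearOrder (ModMon k n r)]
    {p q : LPair R k n r} {a : Amb R k n r}
    (hM : IsModuleOrdering k n r) (ha : a ∈ amb p q) (hr : a.IsRegular) :
    ∃ u : R, a.flip.sig = u • a.sig := by
  obtain ⟨hp, hq⟩ := LC_ne_zero_of_mem_amb ha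
  have n1 := Amb.c₁_ne_zero ha
  have n2 := Amb.c₂_ne_zero ha
  have n3 := Amb.c₁_ne_zero (flip_mem_amb ha)
  have n4 := Amb.c₂_ne_zero (flip_mem_amb ha)
  have e1 := a.lcm_eq_mul_c₁
  have e2 := a.lcm_eq_mul_c₂
  have e3 := a.flip.lcm_eq_mul_c₁
  have e4 := a.flip.lcm_eq_mul_c₂
  -- The lcm is not normalized, so exchanging its arguments may change it by a factor `v`; both
  -- cofactors change by the same factor.
  obtain ⟨v, hv⟩ : ∃ v, lcm (LC a.q.1) (LC a.p.1) = v * lcm (LC a.p.1) (LC a.q.1) := by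
    obtain ⟨v, hv⟩ := lcm_dvd (dvd_lcm_right (LC a.q.1) (LC a.p.1))
      (dvd_lcm_left (LC a.q.1) (LC a.p.1))
    exact ⟨v, by rw [hv, mul_comm]⟩
  change lcm (LC a.q.1) (LC a.p.1) = LC a.q.1 * a.flip.c₁ at e3
  change lcm (LC a.q.1) (LC a.p.1) = LC a.p.1 * a.flip.c₂ at e4
  have k3 : a.flip.c₁ = v * a.c₂ := by
    refine mul_left_cancel₀ hq ?_
    rw [← e3, hv, e2]
    ring
  have k4 : a.flip.c₂ = v * a.c₁ := by
    refine mul_left_cancel₀ hp ?_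
    rw [← e4, hv, e1]
    ring
  have hs : ∀ (v c : R) m b (α : FreeBimod R k n r),
      SigGB.sig (modMul (v * c) m b α) = v • SigGB.sig (modMul c m b α) := by
    intro v c m b α
    rw [sig_modMul hM, sig_modMul hM, modMul, modMul, smul_smul]
  rw [Amb.IsRegular, sigMon_modMul hM one_ne_zero, sigMon_modMul hM one_ne_zero] at hr
  refine ⟨-v, ?_⟩
  rw [Amb.sig, Amb.sig, sigMon_modMul hM n1, sigMon_modMul hM n2, sigMon_modMul hM n3,
    sigMon_modMul hM n4]
  change (if (sigMon a.p.2).map (ModMon.act a.m₁ a.n₁) ≤ (sigMon a.q.2).map (ModMon.act a.m₂ a.n₂)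
    then SigGB.sig (modMul a.flip.c₁ a.m₂ a.n₂ a.q.2)
    else - SigGB.sig (modMul a.flip.c₂ a.m₁ a.n₁ a.p.2)) = _
  rw [k3, k4, hs, hs]
  -- Both orders select the same side, by regularity; the minus sign in front of the second side
  -- moves to the other side, hence the factor `-v`.
  rcases lt_or_gt_of_ne hr with h | h
  · rw [if_pos h.le, if_neg (not_le.2 h), smul_neg, neg_smul, neg_neg]
  · rw [if_neg (not_le.2 h), if_pos h.le, neg_smul]

/-- Multiplying both summands of a cover by the factor relating the two signatures gives a cover of
the flipped ambiguity: scalars do not raise leading monomials, and both orders have the same leading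
monomial. -/
theorem Amb.IsCovered.flip [LinearOrder (ModMon k n r)]
    (hA : IsMonomialOrdering k n) (hM : IsModuleOrdering k n r)
    {p q : LPair R k n r} {a : Amb R k n r} (ha : a ∈ amb p q) (hr : a.IsRegular)
    {G : Set (LPair R k n r)} {H : Set (FreeBimod R k n r)} (h : a.IsCovered G H) :
    a.flip.IsCovered G H := by
  obtain ⟨v, hv⟩ := Amb.exists_flip_sig_eq hM ha hr
  obtain ⟨p', hp', γ, hγ, c, c', m, m', b, b', h1, h2⟩ := h
  refine ⟨p', hp', γ, hγ, v * c, v * c', m, m', b, b', ?_, ?_⟩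
  · rw [hv, h1, smul_add]
    simp only [sig_modMul hM]
    simp only [modMul, smul_smul]
  · rw [Amb.flip_lm hA ha]
    refine lt_of_le_of_lt ?_ h2
    by_cases hc : c = 0
    · simp [hc]
    · rw [LM_polyMul hA hc]
      exact LM_polyMul_le hA _ _ _ _

end GCD

end AmbCoeff

/-! ### Terms that are signatures of multiples of elements of a set -/

section Terms

variable {R : Type*} [CommRing R] {k n r : ℕ}

/-- The term `d μ` is zero or the signature of a multiple of an element of `H`. -/
def IsSigTerm [LinearOrder (ModMon k n r)] (H : Set (FreeBimod R k n r)) (μ : ModMon k n r)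
    (d : R) : Prop :=
  d = 0 ∨ ∃ γ ∈ H, ∃ (σ : ModMon k n r) (m : Mon k n) (b : FreeMonoid (Fin n)),
    sigMon γ = σ ∧ γ σ ∣ d ∧ μ = ModMon.act m b σ

variable [LinearOrder (ModMon k n r)] {H : Set (FreeBimod R k n r)}

theorem IsSigTerm.of_sig_modMul_eq [IsDomain R] (hM : IsModuleOrdering k n r)
    {γ : FreeBimod R k n r} (hγ : γ ∈ insert 0 H) {c d : R} {m : Mon k n}
    {b : FreeMonoid (Fin n)} {μ : ModMon k n r}
    (h : sig (modMul c m b γ) = Finsupp.single μ d) : IsSigTerm H μ d := by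
  by_cases hd : d = 0
  · exact .inl hd
  obtain ⟨h1, h2⟩ := (sig_eq_single_iff hd).1 h
  have hc : c ≠ 0 := by
    rintro rfl
    simp at h1
  have h0 : γ ≠ 0 := by
    rintro rfl
    simp at h1
  obtain ⟨σ, hσ⟩ := exists_sigMon_eq h0
  rw [sigMon_modMul hM hc, hσ, WithBot.map_coe, WithBot.coe_inj] at h1
  refine .inr ⟨γ, hγ.resolve_left h0, σ, m, b, hσ, ⟨c, ?_⟩, h1.symm⟩
  rw [← h2, ← h1, modMul_apply, mul_comm]

theorem IsSigTerm.exists_sig_modMul_eq [IsDomain R] (hM : IsModuleOrdering k n r)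
    {μ : ModMon k n r} {d : R} (h : IsSigTerm H μ d) :
    ∃ γ ∈ insert 0 H, ∃ (c : R) (m : Mon k n) (b : FreeMonoid (Fin n)),
      sig (modMul c m b γ) = Finsupp.single μ d := by
  rcases h with rfl | ⟨γ, hγ, σ, m, b, hσ, ⟨c, rfl⟩, rfl⟩
  · exact ⟨0, Set.mem_insert _ _, 0, 1, 1, by simp⟩
  · refine ⟨γ, Set.mem_insert_of_mem _ hγ, c, m, b, ?_⟩
    rw [sig_modMul hM, sig_of_sigMon_eq hσ, modMul_single, mul_comm]

/-- Turns reducibility into divisibility of coefficients at a fixed monomial, where sums can be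
handled. -/
theorem modReducible_iff [IsDomain R] (hM : IsModuleOrdering k n r) {α : FreeBimod R k n r}
    {μ : ModMon k n r} (hμ : sigMon α = μ) : ModReducible H α ↔ IsSigTerm H μ (α μ) := by
  have hne := (max_support_eq_iff.1 hμ).1
  constructor
  · rintro ⟨γ, hγ, c, m, b, h⟩
    rw [sig_of_sigMon_eq hμ] at h
    exact .of_sig_modMul_eq hM (Set.mem_insert_of_mem _ hγ) h.symm
  · intro h
    obtain ⟨γ, hγ, c, m, b, h⟩ := h.exists_sig_modMul_eq hM
    rcases hγ with rfl | hγ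
    · rw [modMul_zero, sig_zero, eq_comm, Finsupp.single_eq_zero] at h
      exact absurd h hne
    · exact ⟨γ, hγ, c, m, b, by rw [h, sig_of_sigMon_eq hμ]⟩

/-- Realizes a term reached by `H` as the top part of an actual syzygy; only `≤ μ` is claimed
because `d` may be zero. -/
theorem IsSigTerm.exists_syzygy [IsDomain R] (hM : IsModuleOrdering k n r)
    {F : Fin r → MixedAlg R k n} (hH : H ⊆ syzygies F) {μ : ModMon k n r} {d : R}
    (h : IsSigTerm H μ d) : ∃ δ : FreeBimod R k n r, bar F δ = 0 ∧ sigMon δ ≤ μ ∧ δ μ = d := by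
  obtain ⟨γ, hγ, c, m, b, h⟩ := h.exists_sig_modMul_eq hM
  refine ⟨modMul c m b γ, ?_, le_and_apply_of_sig_eq_single h⟩
  have : bar F γ = 0 := by
    rcases hγ with rfl | hγ
    · exact bar_zero F
    · exact hH hγ
  rw [bar_modMul, this, polyMul_zero]

theorem IsSigTerm.act {μ : ModMon k n r} {d : R} (h : IsSigTerm H μ d) (m : Mon k n)
    (b : FreeMonoid (Fin n)) (c : R) : IsSigTerm H (ModMon.act m b μ) (c * d) := by
  rcases h with rfl | ⟨γ, hγ, σ, m', b', hσ, hd, rfl⟩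
  · exact .inl (mul_zero c)
  · exact .inr ⟨γ, hγ, σ, m * m', b' * b, hσ, hd.mul_left c, ModMon.act_act _ _ _ _ _⟩

end Terms

/-! ### Least common multiples of module monomials -/

/-- Both left words are suffixes of one word and both right words are prefixes of one word, so on
each side one contains the other. The longer ones form the lcm, through which the given common
multiple factors. -/
theorem ModMon.exists_isLcm {k n r : ℕ} {σ₁ σ₂ : ModMon k n r} {m₁ m₂ : Mon k n}
    {b₁ b₂ : FreeMonoid (Fin n)} (h : ModMon.act m₁ b₁ σ₁ = ModMon.act m₂ b₂ σ₂) :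
    ∃ (τ : ModMon k n r) (m₁' m₂' m : Mon k n) (b₁' b₂' b : FreeMonoid (Fin n)),
      ModMon.IsLcm σ₁ σ₂ τ ∧ τ = ModMon.act m₁' b₁' σ₁ ∧ τ = ModMon.act m₂' b₂' σ₂ ∧
        ModMon.act m₁ b₁ σ₁ = ModMon.act m b τ := by
  obtain ⟨u₁, x₁, i, y₁⟩ := σ₁
  obtain ⟨u₂, x₂, j, y₂⟩ := σ₂
  obtain ⟨v₁, a₁⟩ := m₁
  obtain ⟨v₂, a₂⟩ := m₂
  simp only [ModMon.act, ModMon.mk.injEq] at h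
  obtain ⟨hu, hx, rfl, hy⟩ := h
  have hu₁ : (u₁ ⊔ u₂) - u₁ + u₁ = u₁ ⊔ u₂ := tsub_add_cancel_of_le le_sup_left
  have hu₂ : (u₁ ⊔ u₂) - u₂ + u₂ = u₁ ⊔ u₂ := tsub_add_cancel_of_le le_sup_right
  have hle : u₁ ⊔ u₂ ≤ v₁ + u₁ :=
    sup_le (le_add_of_nonneg_left zero_le) (hu ▸ le_add_of_nonneg_left zero_le)
  have hv : v₁ + u₁ = v₁ + u₁ - (u₁ ⊔ u₂) + (u₁ ⊔ u₂) := (tsub_add_cancel_of_le hle).symm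
  have left : ∃ x w₁ w₂ w, (((∃ w, x₂ = w * x₁) ∧ x = x₂) ∨ ((∃ w, x₁ = w * x₂) ∧ x = x₁)) ∧
      x = w₁ * x₁ ∧ x = w₂ * x₂ ∧ a₁ * x₁ = w * x := by
    rcases mul_eq_mul_cases hx with ⟨s, rfl, h⟩ | ⟨s, rfl, h⟩
    · exact ⟨x₁, 1, s, a₁, .inr ⟨⟨s, h⟩, rfl⟩, (one_mul _).symm, h, rfl⟩
    · exact ⟨x₂, s, 1, a₂, .inl ⟨⟨s, h⟩, rfl⟩, h, (one_mul _).symm, hx⟩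
  have right : ∃ y w₁ w₂ w, (((∃ w, y₂ = y₁ * w) ∧ y = y₂) ∨ ((∃ w, y₁ = y₂ * w) ∧ y = y₁)) ∧
      y = y₁ * w₁ ∧ y = y₂ * w₂ ∧ y₁ * b₁ = y * w := by
    rcases mul_eq_mul_cases hy with ⟨s, h, rfl⟩ | ⟨s, h, rfl⟩
    · exact ⟨y₂, s, 1, b₂, .inl ⟨⟨s, h⟩, rfl⟩, h, (mul_one _).symm, hy⟩
    · exact ⟨y₁, 1, s, b₁, .inr ⟨⟨s, h⟩, rfl⟩, (mul_one _).symm, h, rfl⟩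
  obtain ⟨x, w₁, w₂, w, hl, hx₁, hx₂, hx₃⟩ := left
  obtain ⟨y, z₁, z₂, z, hr, hy₁, hy₂, hy₃⟩ := right
  refine ⟨⟨u₁ ⊔ u₂, x, i, y⟩, ⟨(u₁ ⊔ u₂) - u₁, w₁⟩, ⟨(u₁ ⊔ u₂) - u₂, w₂⟩,
    ⟨v₁ + u₁ - (u₁ ⊔ u₂), w⟩, z₁, z₂, z, ⟨rfl, rfl, rfl, hl, hr⟩, ?_, ?_, ?_⟩
  · exact ModMon.ext hu₁.symm hx₁ rfl hy₁
  · exact ModMon.ext hu₂.symm hx₂ rfl hy₂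
  · exact ModMon.ext hv hx₃ rfl hy₃

/-! ### Addition of signature terms over a sig-complete set. -/

section SigComplete

variable {R : Type*} [CommRing R] [IsDomain R] [GCDMonoid R] {k n r : ℕ}
  [LinearOrder (ModMon k n r)] {H : Set (FreeBimod R k n r)}

/-- The signature of a sig-combination. -/
theorem sigMon_add_of_gcd (hM : IsModuleOrdering k n r) {γ₁ γ₂ : FreeBimod R k n r}
    {σ₁ σ₂ τ : ModMon k n r} {m₁ m₂ : Mon k n} {b₁ b₂ : FreeMonoid (Fin n)} {c d : R}
    (h₁ : sigMon γ₁ = σ₁) (h₂ : sigMon γ₂ = σ₂) (hτ₁ : τ = ModMon.act m₁ b₁ σ₁)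
    (hτ₂ : τ = ModMon.act m₂ b₂ σ₂) (h : c * γ₁ σ₁ + d * γ₂ σ₂ = gcd (γ₁ σ₁) (γ₂ σ₂)) :
    sigMon (modMul c m₁ b₁ γ₁ + modMul d m₂ b₂ γ₂) = τ ∧
      (modMul c m₁ b₁ γ₁ + modMul d m₂ b₂ γ₂) τ = gcd (γ₁ σ₁) (γ₂ σ₂) := by
  have hval : (modMul c m₁ b₁ γ₁ + modMul d m₂ b₂ γ₂) τ = gcd (γ₁ σ₁) (γ₂ σ₂) := by
    rw [Finsupp.add_apply, ← h]
    nth_rewrite 1 [hτ₁]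
    rw [hτ₂, modMul_apply, modMul_apply]
  refine ⟨max_support_eq_iff.2 ⟨?_, (max_support_add_le _ _).trans (max_le ?_ ?_)⟩, hval⟩
  · rw [hval, Ne, gcd_eq_zero_iff]
    exact fun h0 => (max_support_eq_iff.1 h₁).1 h0.1
  · refine (sigMon_modMul_le hM _ _ _ _).trans ?_
    rw [h₁, hτ₁, WithBot.map_coe]
  · refine (sigMon_modMul_le hM _ _ _ _).trans ?_
    rw [h₂, hτ₂, WithBot.map_coe]

/-- Over a sig-complete set, the coefficients of signatures at a fixed module monomial are closed
under addition. -/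
theorem IsSigTerm.add [IsPrincipalIdealRing R] (hM : IsModuleOrdering k n r)
    (hH : IsSigComplete H) {μ : ModMon k n r} {d₁ d₂ : R} (h₁ : IsSigTerm H μ d₁)
    (h₂ : IsSigTerm H μ d₂) : IsSigTerm H μ (d₁ + d₂) := by
  rcases h₁ with rfl | ⟨γ₁, hγ₁, σ₁, m₁, b₁, hσ₁, hd₁, rfl⟩
  · rwa [zero_add]
  rcases h₂ with rfl | ⟨γ₂, hγ₂, σ₂, m₂, b₂, hσ₂, hd₂, hμ⟩
  · rw [add_zero]
    exact .inr ⟨γ₁, hγ₁, σ₁, m₁, b₁, hσ₁, hd₁, rfl⟩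
  obtain ⟨τ, m₁', m₂', m, b₁', b₂', b, hlcm, hτ₁, hτ₂, hτ⟩ := ModMon.exists_isLcm hμ
  obtain ⟨c, d, hcd⟩ := exists_gcd_eq_mul_add_mul (γ₁ σ₁) (γ₂ σ₂)
  replace hcd : c * γ₁ σ₁ + d * γ₂ σ₂ = gcd (γ₁ σ₁) (γ₂ σ₂) := by
    rw [hcd, mul_comm c, mul_comm d]
  obtain ⟨k1, k2⟩ := sigMon_add_of_gcd hM hσ₁ hσ₂ hτ₁ hτ₂ hcd
  have hred := hH γ₁ hγ₁ γ₂ hγ₂ _ ⟨σ₁, σ₂, τ, m₁', m₂', b₁', b₂', c, d, hσ₁, hσ₂, hlcm, hτ₁, hτ₂,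
    by rw [sigCoeff_of_sigMon_eq hσ₁, sigCoeff_of_sigMon_eq hσ₂, hcd], rfl⟩
  rw [modReducible_iff hM k1, k2] at hred
  -- The sig-combination has the gcd as coefficient at the lcm of the monomials, so a multiple of it
  -- realizes every common combination, in particular the sum.
  obtain ⟨e, he⟩ : gcd (γ₁ σ₁) (γ₂ σ₂) ∣ d₁ + d₂ :=
    dvd_add ((gcd_dvd_left _ _).trans hd₁) ((gcd_dvd_right _ _).trans hd₂)
  rw [he, hτ, mul_comm]
  exact hred.act m b e

end SigComplete

/-! ### Covered ambiguities and G-polynomials -/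

section CoverCriterion

variable {R : Type*} [CommRing R] [IsDomain R] [GCDMonoid R] {k n r : ℕ}
  [LinearOrder (Mon k n)] [LinearOrder (ModMon k n r)]

/-- If a multiple of an element of `G` can be regularly sig-reduced by `G`, then its signature can
be obtained with a smaller leading monomial. -/
theorem exists_smaller_of_isCovered (hA : IsMonomialOrdering k n) (hM : IsModuleOrdering k n r)
    {G : Set (LPair R k n r)} {H : Set (FreeBimod R k n r)} {p q : LPair R k n r}
    (hcov : ∀ a ∈ amb p q, a.IsRegular → a.IsCovered G H)
    {c₁ c₂ : R} {m₁ m₂ : Mon k n} {b₁ b₂ : FreeMonoid (Fin n)} {μ : ModMon k n r} {e : R}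
    (he : e ≠ 0) (hsig : sig (modMul c₁ m₁ b₁ p.2) = Finsupp.single μ e)
    (hne : polyMul c₁ m₁ b₁ p.1 ≠ 0)
    (hLT : LT (polyMul c₂ m₂ b₂ q.1) = LT (polyMul c₁ m₁ b₁ p.1))
    (hlt : sigMon (modMul c₂ m₂ b₂ q.2) < μ) :
    ∃ g ∈ insert 0 G, ∃ (c d : R) (m : Mon k n) (b : FreeMonoid (Fin n)), IsSigTerm H μ d ∧
      sig (modMul c m b g.2) = Finsupp.single μ (e - d) ∧
      LM (polyMul c m b g.1) < LM (polyMul c₁ m₁ b₁ p.1) := by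
  have hc₁ : c₁ ≠ 0 := by
    rintro rfl
    simp at hne
  have hp : p.1 ≠ 0 := fun h => by simp [h] at hne
  obtain ⟨κ, hκ⟩ := exists_LM_eq hp
  have hLM₁ : LM (polyMul c₁ m₁ b₁ p.1) = (m₁ * κ * ⟨0, b₁⟩ : Mon k n) := by
    rw [LM_polyMul hA hc₁, hκ, WithBot.map_coe]
  obtain ⟨hLM₂, hcoeff⟩ := (LT_eq_iff hLM₁).1 hLT
  have hne₂ : polyMul c₂ m₂ b₂ q.1 ≠ 0 := fun h => by simp [h] at hLM₂
  have hc₂ : c₂ ≠ 0 := by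
    rintro rfl
    simp at hne₂
  have hq : q.1 ≠ 0 := fun h => by simp [h] at hne₂
  obtain ⟨ν, hν⟩ := exists_LM_eq hq
  have hmon : m₁ * κ * ⟨0, b₁⟩ = m₂ * ν * ⟨0, b₂⟩ := by
    rw [LM_polyMul hA hc₂, hν, WithBot.map_coe, WithBot.coe_inj] at hLM₂
    exact hLM₂.symm
  have hcc : c₂ * LC q.1 = c₁ * LC p.1 := by
    rw [coeff_polyMul_apply, hmon, coeff_polyMul_apply] at hcoeff
    rw [LC_of_LM_eq hκ, LC_of_LM_eq hν, hcoeff]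
  obtain ⟨a, ha, m, b, rfl, rfl, rfl, rfl⟩ := exists_mem_amb hκ hν hmon
  obtain ⟨hap, haq, -⟩ := id ha
  -- The shared leading coefficient is a multiple of both leading coefficients, so `c₁` contains the
  -- S-polynomial cofactor; `l` is what remains.
  have hd : lcm (LC p.1) (LC q.1) ∣ c₁ * LC p.1 :=
    lcm_dvd (Dvd.intro_left _ rfl) (Dvd.intro_left _ hcc)
  obtain ⟨l, hl⟩ := hd
  have hcl : c₁ = l * a.c₁ := by
    have := a.lcm_eq_mul_c₁
    rw [hap, haq] at this
    refine mul_right_cancel₀ (LC_ne_zero_of_LM_eq hκ) ?_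
    rw [hl, this]
    ring
  have hl0 : l ≠ 0 := by
    rintro rfl
    simp at hcl
    exact hc₁ hcl
  have hsm₁ : sigMon (modMul c₁ (m * a.m₁) (a.n₁ * b) p.2) = μ :=
    ((sig_eq_single_iff he).1 hsig).1
  -- Strict monotonicity cancels the outer factors `m`, `b`: the ambiguity itself is regular and its
  -- signature comes from the side of `p`.
  have hlt' : sigMon (modMul 1 a.m₂ a.n₂ a.q.2) < sigMon (modMul 1 a.m₁ a.n₁ a.p.2) := by
    rw [← hsm₁, ← mul_one c₁, ← mul_one c₂, ← modMul_modMul, ← modMul_modMul,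
      sigMon_modMul hM hc₁, sigMon_modMul hM hc₂] at hlt
    rw [hap, haq]
    exact (hM.strictMono m b).withBot_map.lt_iff_lt.1 hlt
  have hn₁ := Amb.c₁_ne_zero ha
  have hn₂ := Amb.c₂_ne_zero ha
  have hasig : a.sig = sig (modMul a.c₁ a.m₁ a.n₁ p.2) := by
    rw [Amb.sig, if_pos, hap]
    rw [sigMon_modMul hM hn₁, sigMon_modMul hM hn₂]
    rw [sigMon_modMul hM one_ne_zero, sigMon_modMul hM one_ne_zero] at hlt'
    exact hlt'.le
  obtain ⟨g, hg, γ, hγ, c, c', m', m'', b', b'', hs, hlm⟩ := hcov a ha hlt'.ne'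
  -- The cover of `a`, multiplied by `l`, `m`, `b`, represents the original signature.
  have key : sig (modMul l m b (modMul c m' b' g.2)) + sig (modMul l m b (modMul c' m'' b'' γ)) =
      Finsupp.single μ e := by
    rw [sig_modMul hM l, sig_modMul hM l, ← modMul_add, ← hs, hasig, ← sig_modMul hM, ← hsig,
      modMul_modMul, ← hcl]
  obtain ⟨d, hd₁, hd₂⟩ := exists_single_of_sig_add_sig he key
  rw [modMul_modMul] at hd₁ hd₂
  refine ⟨g, hg, _, d, _, _, .of_sig_modMul_eq hM hγ hd₂, hd₁, ?_⟩
  rw [← polyMul_polyMul, hcl, ← polyMul_polyMul, LM_polyMul hA hl0, LM_polyMul hA hl0]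
  refine (hA.strictMono m b).withBot_map ?_
  have : LM (polyMul a.c₁ a.m₁ a.n₁ p.1) = a.lm := by
    rw [Amb.lm, LM_polyMul hA hn₁, LM_polyMul hA one_ne_zero, hap]
  rwa [this]

/-- The leading coefficient of a G-polynomial. -/
theorem Amb.IsGPol.LM_and_coeff (hA : IsMonomialOrdering k n) {p q h : LPair R k n r}
    {a : Amb R k n r} (ha : a ∈ amb p q) (hh : a.IsGPol h) {κ : Mon k n} (hκ : LM p.1 = κ) :
    LM h.1 = (a.m₁ * κ * ⟨0, a.n₁⟩ : Mon k n) ∧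
      h.1.coeff (a.m₁ * κ * ⟨0, a.n₁⟩) = gcd (LC p.1) (LC q.1) := by
  obtain ⟨hap, haq, κ', ν, hκ', hν, -⟩ := id ha
  have hmon := mul_mul_eq_of_mem_amb ha hκ hν
  obtain ⟨c, d, hcd, rfl, -⟩ := hh
  rw [hap, haq] at hcd ⊢
  have hval : (pairMul c a.m₁ a.n₁ p + pairMul d a.m₂ a.n₂ q).1.coeff
      (a.m₁ * κ * ⟨0, a.n₁⟩) = gcd (LC p.1) (LC q.1) := by
    rw [← hcd, LC_of_LM_eq hκ, LC_of_LM_eq hν, Prod.fst_add, MonoidAlgebra.coeff_add,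
      Finsupp.add_apply]
    nth_rewrite 2 [hmon]
    exact congrArg₂ _ (coeff_polyMul_apply _ _ _ _ _) (coeff_polyMul_apply _ _ _ _ _)
  refine ⟨max_support_eq_iff.2 ⟨?_, (max_support_add_le _ _).trans (max_le ?_ ?_)⟩, hval⟩
  · rw [hval, Ne, gcd_eq_zero_iff]
    exact fun h0 => LC_ne_zero_of_LM_eq hκ h0.1
  · refine (LM_polyMul_le hA c a.m₁ a.n₁ p.1).trans ?_
    rw [hκ, WithBot.map_coe]
  · refine (LM_polyMul_le hA d a.m₂ a.n₂ q.1).trans ?_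
    rw [hν, WithBot.map_coe, hmon]

/-- The sum of two leading terms with the same monomial is the leading term of a multiple of an
element of `G`, without larger signatures, if the G-polynomials are sig-reducible by `G`. -/
theorem exists_LT_eq_of_gPol (hA : IsMonomialOrdering k n) (hM : IsModuleOrdering k n r)
    {G : Set (LPair R k n r)} {p q : LPair R k n r}
    (hgp : ∀ a ∈ amb p q, ∃ h, a.IsGPol h ∧ SigReducible G h)
    {c₁ c₂ : R} {m₁ m₂ : Mon k n} {b₁ b₂ : FreeMonoid (Fin n)} {s : WithBot (ModMon k n r)}
    (hs₁ : sigMon (modMul c₁ m₁ b₁ p.2) ≤ s) (hs₂ : sigMon (modMul c₂ m₂ b₂ q.2) ≤ s)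
    {κ : Mon k n} (hκ₁ : LM (polyMul c₁ m₁ b₁ p.1) = κ) (hκ₂ : LM (polyMul c₂ m₂ b₂ q.1) = κ)
    {e : R} (he : e ≠ 0)
    (hadd : (polyMul c₁ m₁ b₁ p.1).coeff κ + (polyMul c₂ m₂ b₂ q.1).coeff κ = e) :
    ∃ g ∈ G, ∃ (c : R) (m : Mon k n) (b : FreeMonoid (Fin n)),
      LM (polyMul c m b g.1) = κ ∧ (polyMul c m b g.1).coeff κ = e ∧
        sigMon (modMul c m b g.2) ≤ s := by
  have hc₁ : c₁ ≠ 0 := by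
    rintro rfl
    simp at hκ₁
  have hc₂ : c₂ ≠ 0 := by
    rintro rfl
    simp at hκ₂
  obtain ⟨κ', hκ'⟩ := exists_LM_eq (f := p.1) fun h => by simp [h] at hκ₁
  obtain ⟨ν', hν'⟩ := exists_LM_eq (f := q.1) fun h => by simp [h] at hκ₂
  rw [LM_polyMul hA hc₁, hκ', WithBot.map_coe, WithBot.coe_inj] at hκ₁
  rw [LM_polyMul hA hc₂, hν', WithBot.map_coe, WithBot.coe_inj] at hκ₂
  obtain ⟨a, ha, m, b, rfl, rfl, rfl, rfl⟩ := exists_mem_amb hκ' hν' (hκ₁.trans hκ₂.symm)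
  obtain ⟨h, hh, g, hg, -, c, m', b', -, hLT, -, hsig⟩ := hgp a ha
  obtain ⟨hLM, hcoeff⟩ := hh.LM_and_coeff hA ha hκ'
  obtain ⟨hLMg, hcg⟩ := (LT_eq_iff hLM).1 hLT
  -- `e` is a sum of multiples of the two leading coefficients; the reducer of the G-polynomial
  -- reaches their gcd, and scaling by `l` reaches `e`.
  obtain ⟨l, hl⟩ : gcd (LC p.1) (LC q.1) ∣ e := by
    rw [← hadd]
    nth_rewrite 1 [← hκ₁]
    rw [← hκ₂, coeff_polyMul_apply, coeff_polyMul_apply, LC_of_LM_eq hκ', LC_of_LM_eq hν']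
    exact dvd_add ((gcd_dvd_left _ _).mul_left _) ((gcd_dvd_right _ _).mul_left _)
  have hl0 : l ≠ 0 := by
    rintro rfl
    exact he (by rw [hl, mul_zero])
  have hκeq : κ = m * (a.m₁ * κ' * ⟨0, a.n₁⟩) * ⟨0, b⟩ := by
    rw [← hκ₁]
    refine Mon.ext ?_ ?_
    · simp [add_assoc]
    · simp [mul_assoc]
  refine ⟨g, hg, l * c, m * m', b' * b, ?_, ?_, ?_⟩
  · rw [← polyMul_polyMul, LM_polyMul hA hl0, hLMg, WithBot.map_coe, hκeq]
  · rw [← polyMul_polyMul, hκeq, coeff_polyMul_apply, hcg, hcoeff, hl, mul_comm]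
  · rw [← modMul_modMul, sigMon_modMul hM hl0]
    have hmono := (hM.strictMono m b).withBot_map.monotone
    refine (hmono hsig).trans ?_
    obtain ⟨-, -, -, -, hgs⟩ := hh
    rw [hgs, Amb.sigMon_sig hM ha, hmono.map_max, ← sigMon_modMul hM hc₁, ← sigMon_modMul hM hc₂,
      modMul_modMul, modMul_modMul, mul_one, mul_one]
    exact max_le hs₁ hs₂

end CoverCriterion

/-! ### The cover criterion -/

theorem eq_zero_of_mem_labeledModule {R : Type*} [CommRing R] {k n r : ℕ}
    {F : Fin r → MixedAlg R k n} {f : LPair R k n r} (hf : f ∈ labeledModule F) (h : f.2 = 0) :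
    f.1 = 0 := by
  rw [show f.1 = bar F f.2 from hf, h, bar_zero]

section Criterion

variable {R : Type*} [CommRing R] {k n r : ℕ} [LinearOrder (Mon k n)] [LinearOrder (ModMon k n r)]
  {F : Fin r → MixedAlg R k n} {G : Set (LPair R k n r)} {H : Set (FreeBimod R k n r)}

/-- Subtracting equal leading terms cancels the top, so the drop of the leading monomial need not be
checked separately. -/
theorem sigReducible_of_mem {f g : LPair R k n r} (hg : g ∈ G) {c : R} {m : Mon k n}
    {b : FreeMonoid (Fin n)} (hf : f.1 ≠ 0) (hLT : LT (polyMul c m b g.1) = LT f.1)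
    (hs : sigMon (modMul c m b g.2) ≤ sigMon f.2) : SigReducible G f := by
  obtain ⟨κ, hκ⟩ := exists_LM_eq hf
  obtain ⟨h1, h2⟩ := (LT_eq_iff hκ).1 hLT
  refine ⟨g, hg, _, c, m, b, rfl, hLT, ?_, hs⟩
  rw [hκ]
  exact max_support_sub_lt hκ.le h1.le h2.symm

variable [IsDomain R] [GCDMonoid R]

/-- Every term at `μ` is obtained from multiples of elements of `G` and `H` such that the leading
term of the former is not the leading term of an element of smaller signature. -/
theorem exists_irreducible_representation [IsPrincipalIdealRing R]
    (hA : IsMonomialOrdering k n)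
    (hM : IsModuleOrdering k n r) (hG : G ⊆ labeledModule F) (hsc : IsSigComplete H)
    (hred : ∀ μ, IsSigTerm (H ∪ Prod.snd '' G) μ (1 : R))
    (hcov : ∀ p ∈ G, ∀ q ∈ G, ∀ a ∈ amb p q, a.IsRegular → a.IsCovered G H) {μ : ModMon k n r}
    (ih : ∀ f ∈ labeledModule F, sigMon f.2 < μ → f.1 ≠ 0 → SigReducible G f) (e : R) :
    ∃ g ∈ insert 0 G, ∃ (c d : R) (m : Mon k n) (b : FreeMonoid (Fin n)), IsSigTerm H μ d ∧
      sig (modMul c m b g.2) = Finsupp.single μ (e - d) ∧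
      ∀ f ∈ labeledModule F, sigMon f.2 < μ → f.1 ≠ 0 → LT f.1 ≠ LT (polyMul c m b g.1) := by
  -- The leading monomials of all admissible splittings of `e μ`. The value `⊥` is included, so the
  -- splitting with zero polynomial part competes as well.
  let S : Set (WithBot (Mon k n)) := {M | ∃ g ∈ insert 0 G, ∃ (c d : R) (m : Mon k n)
    (b : FreeMonoid (Fin n)), IsSigTerm H μ d ∧
      sig (modMul c m b g.2) = Finsupp.single μ (e - d) ∧ LM (polyMul c m b g.1) = M}
  have hS : S.Nonempty := by
    rcases hred μ with h1 | ⟨γ, hγ, σ, m, b, hσ, hd, hμ⟩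
    · exact absurd h1 one_ne_zero
    replace hd : γ σ ∣ e := hd.trans (one_dvd e)
    rcases hγ with hγ | ⟨g, hg, rfl⟩
    -- If `H` reaches `μ`, it takes the whole coefficient `e` and the part from `G` is zero.
    · exact ⟨_, 0, Set.mem_insert _ _, 0, e, 1, 1, .inr ⟨γ, hγ, σ, m, b, hσ, hd, hμ⟩, by simp,
        rfl⟩
    · obtain ⟨c, hc⟩ := hd
      refine ⟨_, g, Set.mem_insert_of_mem _ hg, c, 0, m, b, .inl rfl, ?_, rfl⟩
      rw [sig_modMul hM, sig_of_sigMon_eq hσ, modMul_single, hμ, hc, sub_zero, mul_comm]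
  have := hA.wellFounded
  have hwf : WellFounded (fun x y : WithBot (Mon k n) => x < y) := wellFounded_lt
  obtain ⟨g, hg, c, d, m, b, hd, hsig, hLM⟩ := hwf.min_mem S hS
  refine ⟨g, hg, c, d, m, b, hd, hsig, fun f hf hlt hne hLT => ?_⟩
  have hne' : polyMul c m b g.1 ≠ 0 := by
    intro h
    rw [h] at hLT
    exact hne (LM_eq_bot_iff.1 (by rw [← LM_LT, hLT, LM_LT, LM_zero]))
  have hgG : g ∈ G := hg.resolve_left fun h => by simp [h] at hne'
  -- A multiple with zero signature has zero label, hence zero polynomial part.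
  have hed : e - d ≠ 0 := by
    intro h
    rw [h, Finsupp.single_zero, ← sigMon_eq_bot_iff, sigMon_sig, sigMon_eq_bot_iff] at hsig
    exact hne' (eq_zero_of_mem_labeledModule (pairMul_mem_labeledModule c m b (hG hgG)) hsig)
  obtain ⟨q, hq, h, c₂, m₂, b₂, -, hLT₂, -, hs₂⟩ := ih f hf hlt hne
  obtain ⟨g', hg', c', d', m', b', hd', hsig', hlt'⟩ := exists_smaller_of_isCovered hA hM
    (hcov g hgG q hq) hed hsig hne' (hLT₂.trans hLT) (hs₂.trans_lt hlt)
  -- The new splitting of `(e - d) μ` together with the old part `d μ` is a splitting of `e μ`,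
  -- against minimality.
  refine hwf.not_lt_min S (x := LM (polyMul c' m' b' g'.1)) ?_ (hLM ▸ hlt')
  exact ⟨g', hg', c', d + d', m', b', hd.add hM hsc hd', by rw [hsig', sub_sub], rfl⟩

/-- The irreducible multiple, corrected by a syzygy, has the same signature term as `f`. Their
difference lies below `μ`, where the induction hypothesis and irreducibility apply. Both the zero
and the nonzero case come from this comparison. -/
theorem sigReducible_of_irreducible_representation (hA : IsMonomialOrdering k n)
    (hM : IsModuleOrdering k n r) (hG : G ⊆ labeledModule F) (hG0 : ∀ g ∈ G, g.1 ≠ 0)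
    (hH : H ⊆ syzygies F)
    (hgp : ∀ p ∈ G, ∀ q ∈ G, (∀ a ∈ amb p q, ∃ h, a.IsGPol h ∧ SigReducible G h) ∨
      ∀ a ∈ amb q p, ∃ h, a.IsGPol h ∧ SigReducible G h) {μ : ModMon k n r}
    (ih : ∀ f ∈ labeledModule F, sigMon f.2 < μ → f.1 ≠ 0 → SigReducible G f)
    {f : LPair R k n r} (hf : f ∈ labeledModule F) (hfμ : sigMon f.2 = μ)
    {g : LPair R k n r} (hg : g ∈ insert 0 G) {c d : R} {m : Mon k n} {b : FreeMonoid (Fin n)}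
    (hd : IsSigTerm H μ d) (hsig : sig (modMul c m b g.2) = Finsupp.single μ (f.2 μ - d))
    (hirr : ∀ f ∈ labeledModule F, sigMon f.2 < μ → f.1 ≠ 0 → LT f.1 ≠ LT (polyMul c m b g.1)) :
    (f.1 = 0 → f.2 μ = d) ∧ (f.1 ≠ 0 → SigReducible G f) := by
  -- The syzygy `δ` restores the coefficient `d` missing at `μ` without changing the polynomial
  -- part.
  obtain ⟨δ, hδ, hδμ, hδd⟩ := hd.exists_syzygy hM hH
  have hgl : g ∈ labeledModule F := by
    rcases hg with rfl | hg
    · exact (bar_zero F).symm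
    · exact hG hg
  obtain ⟨hs1, hs2⟩ := le_and_apply_of_sig_eq_single hsig
  have hδl : ((0, δ) : LPair R k n r) ∈ labeledModule F := hδ.symm
  have hxl : pairMul c m b g + (0, δ) ∈ labeledModule F :=
    add_mem_labeledModule (pairMul_mem_labeledModule c m b hgl) hδl
  have hx1 : (pairMul c m b g + (0, δ)).1 = polyMul c m b g.1 := by simp [pairMul]
  have hx2 : (pairMul c m b g + (0, δ)).2 = modMul c m b g.2 + δ := rfl
  generalize pairMul c m b g + (0, δ) = x at hxl hx1 hx2
  have hxμ : sigMon x.2 ≤ μ := hx2 ▸ (max_support_add_le _ _).trans (max_le hs1 hδμ)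
  have hxv : x.2 μ = f.2 μ := by
    rw [hx2, Finsupp.add_apply, hs2, hδd, sub_add_cancel]
  have hsub : sigMon (f - x).2 < μ := max_support_sub_lt hfμ.le hxμ hxv.symm
  have hsub' : sigMon (x - f).2 < μ := max_support_sub_lt hxμ hfμ.le hxv
  have hfx := sub_mem_labeledModule hf hxl
  have hxf := sub_mem_labeledModule hxl hf
  rw [← hx1] at hirr
  constructor
  · intro hf0
    have hx0 : x.1 = 0 := by
      by_contra hne
      refine hirr (x - f) hxf hsub' ?_ ?_
      · simpa [hf0] using hne
      · rw [Prod.fst_sub, hf0, sub_zero]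
    -- If `d` were not the whole coefficient, `x.1` would be a nonzero multiple of some `g` in `G`,
    -- whose polynomial part is nonzero.
    by_contra hne
    have hsm := ((sig_eq_single_iff (sub_ne_zero.2 hne)).1 hsig).1
    have hc : c ≠ 0 := by
      rintro rfl
      simp at hsm
    have hgG : g ∈ G := hg.resolve_left fun h => by simp [h] at hsm
    exact polyMul_ne_zero hA hc m b (hG0 g hgG) (hx1 ▸ hx0)
  · intro hf0
    obtain ⟨κ, hκ⟩ := exists_LM_eq hf0
    rcases lt_trichotomy (LM x.1) κ with hlt | heq | hgt
    · have hxκ := max_support_lt_iff.1 hlt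
      -- The leading term of `f` survives in `f - x`, so a reducer of the latter serves for `f`.
      have h1 : LM (f - x).1 = κ := max_support_eq_iff.2
        ⟨by simpa [hxκ.1] using (max_support_eq_iff.1 hκ).1,
          (max_support_sub_le _ _).trans (max_le hκ.le hlt.le)⟩
      have h2 : (f - x).1 ≠ 0 := fun h => by simp [h] at h1
      obtain ⟨q, hq, -, c', m', b', -, hLT, -, hs⟩ := ih _ hfx hsub h2
      refine sigReducible_of_mem hq hf0 (hLT.trans ?_) (hs.trans (hsub.le.trans hfμ.ge))
      exact (LT_eq_iff hκ).2 ⟨h1, by simp [hxκ.1]⟩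
    · have hxne : x.1 ≠ 0 := fun h => by simp [h] at heq
      have hgG : g ∈ G := hg.resolve_left fun h => by simp [hx1, h] at hxne
      by_cases hco : f.1.coeff κ = x.1.coeff κ
      · refine sigReducible_of_mem hgG hf0 ?_ (hs1.trans hfμ.ge)
        rw [← hx1]
        exact (LT_eq_iff hκ).2 ⟨heq, hco.symm⟩
      · have h1 : LM (f - x).1 = κ := max_support_eq_iff.2
          ⟨by simpa [sub_eq_zero] using hco,
            (max_support_sub_le _ _).trans (max_le hκ.le heq.le)⟩
        have h2 : (f - x).1 ≠ 0 := fun h => by simp [h] at h1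
        obtain ⟨q, hq, -, c', m', b', -, hLT, -, hs⟩ := ih _ hfx hsub h2
        obtain ⟨hq1, hq2⟩ := (LT_eq_iff h1).1 hLT
        have hfne := (max_support_eq_iff.1 hκ).1
        -- The leading term of `f` is the sum of those of the multiples of `g` and `q`, both of
        -- signature at most `μ`.
        have hsum : (polyMul c m b g.1).coeff κ + (polyMul c' m' b' q.1).coeff κ =
            f.1.coeff κ := by
          rw [hq2, ← hx1]
          simp
        rw [hx1] at heq
        have hs' := hs.trans hsub.le
        obtain ⟨g', hg', c'', m'', b'', k1, k2, k3⟩ : ∃ g ∈ G, ∃ (c : R) (m : Mon k n)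
            (b : FreeMonoid (Fin n)), LM (polyMul c m b g.1) = κ ∧
              (polyMul c m b g.1).coeff κ = f.1.coeff κ ∧ sigMon (modMul c m b g.2) ≤ μ := by
          rcases hgp g hgG q hq with h | h
          · exact exists_LT_eq_of_gPol hA hM h hs1 hs' heq hq1 hfne hsum
          · exact exists_LT_eq_of_gPol hA hM h hs' hs1 hq1 heq hfne (by rw [add_comm, hsum])
        exact sigReducible_of_mem hg' hf0 ((LT_eq_iff hκ).2 ⟨k1, k2⟩) (k3.trans hfμ.ge)
    · have hxne : x.1 ≠ 0 := fun h => by simp [h] at hgt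
      obtain ⟨ν, hν⟩ := exists_LM_eq hxne
      have hfν := max_support_lt_iff.1 (show LM f.1 < ν by rw [hκ, ← hν]; exact hgt)
      -- Here `x - f` would keep the leading term of `x` with a smaller signature, which
      -- irreducibility excludes.
      have h1 : LM (x - f).1 = ν := max_support_eq_iff.2
        ⟨by simpa [hfν.1] using (max_support_eq_iff.1 hν).1,
          (max_support_sub_le _ _).trans (max_le hν.le hfν.2)⟩
      have h2 : (x - f).1 ≠ 0 := fun h => by simp [h] at h1
      exact absurd ((LT_eq_iff hν).2 ⟨h1, by simp [hfν.1]⟩) (hirr _ hxf hsub' h2)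

/-- The cover criterion. -/
theorem isSigGroebnerBasis_and_isSyzygyBasis [IsPrincipalIdealRing R]
    (hA : IsMonomialOrdering k n) (hM : IsModuleOrdering k n r) (hG : G ⊆ labeledModule F)
    (hG0 : ∀ g ∈ G, g.1 ≠ 0) (hH : H ⊆ syzygies F) (hsc : IsSigComplete H)
    (hred : ∀ μ, IsSigTerm (H ∪ Prod.snd '' G) μ (1 : R))
    (hgp : ∀ p ∈ G, ∀ q ∈ G, (∀ a ∈ amb p q, ∃ h, a.IsGPol h ∧ SigReducible G h) ∨
      ∀ a ∈ amb q p, ∃ h, a.IsGPol h ∧ SigReducible G h)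
    (hcov : ∀ p ∈ G, ∀ q ∈ G, ∀ a ∈ amb p q, a.IsRegular → a.IsCovered G H) :
    IsSigGroebnerBasis F G ∧ IsSyzygyBasis F H := by
  have hwf := hM.wellFounded
  have main : ∀ μ : ModMon k n r, ∀ f ∈ labeledModule F, sigMon f.2 = μ → f.1 ≠ 0 →
      SigReducible G f := by
    intro μ
    induction μ using WellFoundedLT.induction with
    | ind μ ih =>
      have ih' : ∀ f ∈ labeledModule F, sigMon f.2 < μ → f.1 ≠ 0 → SigReducible G f := by
        intro f hf hlt hf0
        obtain ⟨ν, hν⟩ := exists_sigMon_eq fun h => hf0 (eq_zero_of_mem_labeledModule hf h)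
        exact ih ν (WithBot.coe_lt_coe.1 (hν ▸ hlt)) f hf hν hf0
      intro f hf hfμ
      obtain ⟨g, hg, c, d, m, b, hd, hsig, hirr⟩ :=
        exists_irreducible_representation hA hM hG hsc hred hcov ih' (f.2 μ)
      exact (sigReducible_of_irreducible_representation hA hM hG hG0 hH hgp ih' hf hfμ hg hd hsig
        hirr).2
  have main' : ∀ f ∈ labeledModule F, f.1 ≠ 0 → SigReducible G f := by
    intro f hf hf0
    obtain ⟨μ, hμ⟩ := exists_sigMon_eq fun h => hf0 (eq_zero_of_mem_labeledModule hf h)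
    exact main μ f hf hμ hf0
  refine ⟨⟨hG, main'⟩, hH, fun α hα hα0 => ?_⟩
  obtain ⟨μ, hμ⟩ := exists_sigMon_eq hα0
  have ih : ∀ f ∈ labeledModule F, sigMon f.2 < μ → f.1 ≠ 0 → SigReducible G f :=
    fun f hf _ => main' f hf
  obtain ⟨g, hg, c, d, m, b, hd, hsig, hirr⟩ :=
    exists_irreducible_representation hA hM hG hsc hred hcov ih (α μ)
  -- A syzygy is a label of the zero polynomial; the vanishing case forces its entire leading
  -- coefficient to be reached by `H`.
  have hf : ((0, α) : LPair R k n r) ∈ labeledModule F := Eq.symm hα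
  rw [modReducible_iff hM hμ, (sigReducible_of_irreducible_representation hA hM hG hG0 hH hgp ih
    hf hμ hg hd hsig hirr).1 rfl]
  exact hd

end Criterion

/-! ### Regular sig-reductions -/

section Reductions

variable {R : Type*} [CommRing R] {k n r : ℕ} [LinearOrder (ModMon k n r)]

theorem sig_sub_of_lt {α β : FreeBimod R k n r} (h : sigMon β < sigMon α) :
    sig (α - β) = sig α := by
  obtain ⟨μ, hμ⟩ := WithBot.ne_bot_iff_exists.1 h.ne_bot
  obtain ⟨h1, h2⟩ := max_support_lt_iff.1 (hμ ▸ h)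
  have h3 := max_support_eq_iff.1 hμ.symm
  have : sigMon (α - β) = μ := max_support_eq_iff.2
    ⟨by simpa [h1] using h3.1, (max_support_sub_le _ _).trans (max_le h3.2 h2)⟩
  rw [sig_of_sigMon_eq this, sig_of_sigMon_eq hμ.symm, Finsupp.sub_apply, h1, sub_zero]

variable [LinearOrder (Mon k n)] {F : Fin r → MixedAlg R k n} {G : Set (LPair R k n r)}
  {p p' : LPair R k n r}

theorem RegSigReducesTo.mem_labeledModule (h : RegSigReducesTo G p p')
    (hG : G ⊆ labeledModule F) (hp : p ∈ labeledModule F) : p' ∈ labeledModule F := by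
  obtain ⟨h, -⟩ := h
  induction h with
  | refl => exact hp
  | tail _ h ih =>
    obtain ⟨q, hq, c, m, b, rfl, -⟩ := h
    exact sub_mem_labeledModule ih (pairMul_mem_labeledModule c m b (hG hq))

theorem RegSigReducesTo.sig_eq (h : RegSigReducesTo G p p') : sig p'.2 = sig p.2 := by
  obtain ⟨h, -⟩ := h
  induction h with
  | refl => rfl
  | tail _ h ih =>
    obtain ⟨q, hq, c, m, b, rfl, -, -, hs⟩ := h
    rw [← ih]
    exact sig_sub_of_lt hs

theorem RegSigReducesTo.LM_le (h : RegSigReducesTo G p p') : LM p'.1 ≤ LM p.1 := by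
  obtain ⟨h, -⟩ := h
  induction h with
  | refl => exact le_rfl
  | tail _ h ih =>
    obtain ⟨q, hq, c, m, b, rfl, -, hlt, -⟩ := h
    exact hlt.le.trans ih

/-- If any step takes place, the first one is itself a sig-reduction of `p`. -/
theorem RegSigReducesTo.eq_or_sigReducible (h : RegSigReducesTo G p p') :
    p = p' ∨ SigReducible G p := by
  rcases h.1.cases_head with h | ⟨v, ⟨q, hq, c, m, b, hv, hLT, hlt, hs⟩, -⟩
  · exact .inl h
  · exact .inr ⟨q, hq, v, c, m, b, hv, hLT, hlt, hs.le⟩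

theorem SigReducible.mono {G' : Set (LPair R k n r)} (h : SigReducible G p) (hG : G ⊆ G') :
    SigReducible G' p := by
  obtain ⟨q, hq, h⟩ := h
  exact ⟨q, hG hq, h⟩

theorem sigReducible_self (hp : p ∈ G) (h0 : p.1 ≠ 0) : SigReducible G p := by
  refine sigReducible_of_mem hp (c := 1) (m := 1) (b := 1) h0 ?_ ?_
  · rw [one_polyMul]
  · rw [one_modMul]

end Reductions

/-! ### S-polynomials, G-polynomials and sig-combinations -/

theorem SigCombClosure.mem_syzygies {R : Type*} [CommRing R] [GCDMonoid R] {k n r : ℕ}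
    [LinearOrder (ModMon k n r)] {F : Fin r → MixedAlg R k n} {H : Set (FreeBimod R k n r)}
    (hH : H ⊆ syzygies F) {γ : FreeBimod R k n r} (h : SigCombClosure H γ) : γ ∈ syzygies F := by
  induction h with
  | base γ hγ => exact hH hγ
  | comb γ₁ γ₂ δ _ _ hδ ih₁ ih₂ =>
    obtain ⟨_, _, _, m₁, m₂, b₁, b₂, c, d, -, -, -, -, -, -, rfl⟩ := hδ
    change bar F _ = 0
    rw [bar_add, bar_modMul, bar_modMul, show bar F γ₁ = 0 from ih₁, show bar F γ₂ = 0 from ih₂,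
      polyMul_zero, polyMul_zero, add_zero]

section SPol

variable {R : Type*} [CommRing R] [GCDMonoid R] {k n r : ℕ}
  [LinearOrder (Mon k n)] {F : Fin r → MixedAlg R k n} {p q : LPair R k n r} {a : Amb R k n r}

theorem Amb.LM_sPol_lt [IsDomain R] (hA : IsMonomialOrdering k n) (ha : a ∈ amb p q) :
    LM a.sPol.1 < a.lm := by
  obtain ⟨hap, haq, κ, ν, hκ, hν, -⟩ := id ha
  have hmon := mul_mul_eq_of_mem_amb ha hκ hν
  have e1 := a.lcm_eq_mul_c₁
  rw [a.lcm_eq_mul_c₂] at e1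
  rw [Amb.lm_eq hA ha hκ]
  have h1 : LM (polyMul a.c₁ a.m₁ a.n₁ a.p.1) = (a.m₁ * κ * ⟨0, a.n₁⟩ : Mon k n) := by
    rw [LM_polyMul hA (Amb.c₁_ne_zero ha), hap, hκ, WithBot.map_coe]
  have h2 : LM (polyMul a.c₂ a.m₂ a.n₂ a.q.1) = (a.m₁ * κ * ⟨0, a.n₁⟩ : Mon k n) := by
    rw [LM_polyMul hA (Amb.c₂_ne_zero ha), haq, hν, WithBot.map_coe, hmon]
  refine max_support_sub_lt h1.le h2.le ?_
  change (polyMul a.c₁ a.m₁ a.n₁ a.p.1).coeff _ = (polyMul a.c₂ a.m₂ a.n₂ a.q.1).coeff _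
  rw [coeff_polyMul_apply, hmon, coeff_polyMul_apply, hap, haq, ← LC_of_LM_eq hκ,
    ← LC_of_LM_eq hν, mul_comm, ← hap, ← haq, ← e1, mul_comm]

/-- Regularity excludes cancellation of the two signatures, so the larger side survives with its
sign. -/
theorem Amb.sig_sPol [IsDomain R] [LinearOrder (ModMon k n r)] (hM : IsModuleOrdering k n r) (ha : a ∈ amb p q)
    (hr : a.IsRegular) : SigGB.sig a.sPol.2 = a.sig := by
  rw [Amb.IsRegular, sigMon_modMul hM one_ne_zero, sigMon_modMul hM one_ne_zero,
    ← sigMon_modMul hM (Amb.c₁_ne_zero ha), ← sigMon_modMul hM (Amb.c₂_ne_zero ha)] at hr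
  change SigGB.sig (modMul a.c₁ a.m₁ a.n₁ a.p.2 - modMul a.c₂ a.m₂ a.n₂ a.q.2) = _
  rw [Amb.sig]
  split_ifs with h
  · exact sig_sub_of_lt (lt_of_le_of_ne h hr.symm)
  · have hneg : ∀ α : FreeBimod R k n r, SigGB.sig (-α) = -SigGB.sig α := by
      intro α
      have h := sig_modMul hM (-1 : R) 1 1 α
      have e : ∀ β : FreeBimod R k n r, modMul (-1 : R) 1 1 β = -β := by
        intro β
        conv_rhs => rw [← one_modMul β]
        simp only [modMul, neg_smul, one_smul]
      rwa [e, e] at h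
    rw [← neg_sub, hneg, sig_sub_of_lt (not_le.1 h)]

theorem Amb.sPol_mem_labeledModule (ha : a ∈ amb p q) (hp : p ∈ labeledModule F)
    (hq : q ∈ labeledModule F) : a.sPol ∈ labeledModule F := by
  obtain ⟨rfl, rfl, -⟩ := ha
  exact sub_mem_labeledModule (pairMul_mem_labeledModule _ _ _ hp)
    (pairMul_mem_labeledModule _ _ _ hq)

theorem Amb.IsGPol.mem_labeledModule [LinearOrder (ModMon k n r)] {h : LPair R k n r}
    (hh : a.IsGPol h) (ha : a ∈ amb p q) (hp : p ∈ labeledModule F) (hq : q ∈ labeledModule F) :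
    h ∈ labeledModule F := by
  obtain ⟨rfl, rfl, -⟩ := ha
  obtain ⟨c, d, -, rfl, -⟩ := hh
  exact add_mem_labeledModule (pairMul_mem_labeledModule _ _ _ hp)
    (pairMul_mem_labeledModule _ _ _ hq)

/-- Its leading coefficient is the gcd of two nonzero elements. -/
theorem Amb.IsGPol.ne_zero [IsDomain R] [LinearOrder (ModMon k n r)] (hA : IsMonomialOrdering k n)
    {h : LPair R k n r} (hh : a.IsGPol h) (ha : a ∈ amb p q) : h.1 ≠ 0 := by
  obtain ⟨-, -, κ, ν, hκ, hν, -⟩ := id ha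
  intro h0
  have := (hh.LM_and_coeff hA ha hκ).1
  simp [h0] at this

end SPol

/-! ### Runs of the algorithm -/

namespace Run

variable {R : Type*} [CommRing R] [GCDMonoid R] {k n r : ℕ}
  [LinearOrder (Mon k n)] [LinearOrder (ModMon k n r)] {F : Fin r → MixedAlg R k n} (ρ : Run F)

/-- What the algorithm guarantees about the values of its variables before the `j`-th run through
the loop. -/
structure Invariant (ρ : Run F) (j : ℕ) : Prop where
  G_subset : (ρ.state j).G ⊆ labeledModule F
  G_ne_zero : ∀ p ∈ (ρ.state j).G, p.1 ≠ 0
  H_subset : (ρ.state j).H ⊆ syzygies F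
  H_complete : IsSigComplete (ρ.state j).H
  P_subset : ∀ x ∈ (ρ.state j).P, x.1 ∈ labeledModule F

theorem invariant (j : ℕ) : ρ.Invariant j := by
  induction j with
  | zero =>
    constructor <;> rw [ρ.state_zero]
    · exact Set.empty_subset _
    · exact fun p hp => absurd hp (Set.notMem_empty p)
    · exact Set.empty_subset _
    · exact fun γ hγ => absurd hγ (Set.notMem_empty γ)
    · rintro x ⟨i, rfl⟩
      exact (bar_eps F i).symm
  | succ j ih =>
    rcases ρ.step j with ⟨x, -, hx, ⟨-, hG, hH, hP⟩ | ⟨-, p', hp', ⟨h0, hG, hH, hP⟩ |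
      ⟨h0, hG, hH, hP⟩⟩⟩ | ⟨-, -, hs⟩
    · constructor
      · exact hG ▸ ih.G_subset
      · exact hG ▸ ih.G_ne_zero
      · exact hH ▸ ih.H_subset
      · exact hH ▸ ih.H_complete
      · rw [hP]
        exact fun y hy => ih.P_subset y hy.1
    · have hl := hp'.mem_labeledModule ih.G_subset (ih.P_subset x hx)
      constructor
      · exact hG ▸ ih.G_subset
      · exact hG ▸ ih.G_ne_zero
      · refine fun γ hγ => (hH.2.1 γ hγ).mem_syzygies (Set.insert_subset ?_ ih.H_subset)
        change bar F p'.2 = 0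
        rw [← show p'.1 = bar F p'.2 from hl, h0]
      · exact hH.2.2
      · rw [hP]
        exact fun y hy => ih.P_subset y hy.1
    · have hl := hp'.mem_labeledModule ih.G_subset (ih.P_subset x hx)
      have hG' : (ρ.state (j + 1)).G ⊆ labeledModule F :=
        hG ▸ Set.insert_subset hl ih.G_subset
      refine ⟨hG', ?_, hH ▸ ih.H_subset, hH ▸ ih.H_complete, ?_⟩
      · rw [hG]
        rintro p (rfl | hp)
        · exact h0
        · exact ih.G_ne_zero p hp
      · rw [hP]
        rintro y (hy | ⟨g, hg, a, ha, ⟨-, rfl⟩ | rfl⟩)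
        · exact ih.P_subset y hy.1
        · exact Amb.sPol_mem_labeledModule ha hl (hG' hg)
        · exact (ρ.isGPol p' hl g (hG' hg) a ha).mem_labeledModule ha hl (hG' hg)
    · constructor <;> rw [hs]
      exacts [ih.G_subset, ih.G_ne_zero, ih.H_subset, ih.H_complete, ih.P_subset]

theorem monotone_G : Monotone fun j => (ρ.state j).G := by
  refine monotone_nat_of_le_succ fun j => ?_
  change (ρ.state j).G ⊆ (ρ.state (j + 1)).G
  rcases ρ.step j with ⟨x, -, -, ⟨-, hG, -⟩ | ⟨-, p', -, ⟨-, hG, -⟩ | ⟨-, hG, -⟩⟩⟩ | ⟨-, -, hs⟩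
  · rw [hG]
  · rw [hG]
  · rw [hG]
    exact Set.subset_insert _ _
  · rw [hs]

theorem monotone_H : Monotone fun j => (ρ.state j).H := by
  refine monotone_nat_of_le_succ fun j => ?_
  change (ρ.state j).H ⊆ (ρ.state (j + 1)).H
  rcases ρ.step j with ⟨x, -, -, ⟨-, -, hH, -⟩ | ⟨-, p', -, ⟨-, -, hH, -⟩ | ⟨-, -, hH, -⟩⟩⟩ |
    ⟨-, -, hs⟩
  · rw [hH]
  · exact (Set.subset_insert _ _).trans hH.1
  · rw [hH]
  · rw [hs]

theorem G_subset_basis (j : ℕ) : (ρ.state j).G ⊆ ρ.basis :=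
  Set.subset_iUnion (fun j => (ρ.state j).G) j

theorem H_subset_syz (j : ℕ) : (ρ.state j).H ⊆ ρ.syz :=
  Set.subset_iUnion (fun j => (ρ.state j).H) j

theorem exists_mem_G {p q : LPair R k n r} (hp : p ∈ ρ.basis) (hq : q ∈ ρ.basis) :
    ∃ j, p ∈ (ρ.state j).G ∧ q ∈ (ρ.state j).G := by
  obtain ⟨i, hi⟩ := Set.mem_iUnion.1 hp
  obtain ⟨j, hj⟩ := Set.mem_iUnion.1 hq
  exact ⟨max i j, ρ.monotone_G (le_max_left i j) hi, ρ.monotone_G (le_max_right i j) hj⟩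

theorem basis_subset : ρ.basis ⊆ labeledModule F :=
  Set.iUnion_subset fun j => (ρ.invariant j).G_subset

theorem basis_ne_zero {p : LPair R k n r} (hp : p ∈ ρ.basis) : p.1 ≠ 0 := by
  obtain ⟨j, hj⟩ := Set.mem_iUnion.1 hp
  exact (ρ.invariant j).G_ne_zero p hj

theorem syz_subset : ρ.syz ⊆ syzygies F :=
  Set.iUnion_subset fun j => (ρ.invariant j).H_subset

/-- A sig-combination has only two inputs. Both are present at a common stage, and the set is
already sig-complete there. -/
theorem isSigComplete_syz : IsSigComplete ρ.syz := by
  intro γ₁ h₁ γ₂ h₂ δ hδ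
  obtain ⟨i, hi⟩ := Set.mem_iUnion.1 h₁
  obtain ⟨j, hj⟩ := Set.mem_iUnion.1 h₂
  obtain ⟨γ, hγ, h⟩ := (ρ.invariant (max i j)).H_complete γ₁ (ρ.monotone_H (le_max_left i j) hi)
    γ₂ (ρ.monotone_H (le_max_right i j) hj) δ hδ
  exact ⟨γ, ρ.H_subset_syz _ hγ, h⟩

/-- What happens to a selected element. -/
theorem of_sel_eq {j : ℕ} {x : Item R k n r} (hx : ρ.sel j = some x) :
    x ∈ (ρ.state j).P ∧ (Skipped (ρ.state j) x ∨ ∃ p', RegSigReducesTo (ρ.state j).G x.1 p' ∧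
      ((p'.1 = 0 ∧ p'.2 ∈ (ρ.state (j + 1)).H) ∨ (p'.1 ≠ 0 ∧ p' ∈ (ρ.state (j + 1)).G))) := by
  rcases ρ.step j with ⟨y, hy, hyP, h⟩ | ⟨h, -⟩
  · obtain rfl : y = x := Option.some_injective _ (hy.symm.trans hx)
    refine ⟨hyP, ?_⟩
    rcases h with ⟨h, -⟩ | ⟨-, p', hp', ⟨h0, -, hH, -⟩ | ⟨h0, hG, -⟩⟩
    · exact .inl h
    · exact .inr ⟨p', hp', .inl ⟨h0, hH.1 (Set.mem_insert _ _)⟩⟩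
    · exact .inr ⟨p', hp', .inr ⟨h0, hG ▸ Set.mem_insert _ _⟩⟩
  · rw [h] at hx
    exact absurd hx (by simp)

/-- After the `i`-th generator is processed, all terms with index `i` are reducible. -/
theorem sel_input [IsDomain R] (hM : IsModuleOrdering k n r) {j : ℕ} {i : Fin r}
    (hj : ρ.sel j = some (inputItem F i)) (μ : ModMon k n r) (hμ : μ.idx = i) :
    IsSigTerm (ρ.syz ∪ Prod.snd '' ρ.basis) μ (1 : R) := by
  obtain ⟨-, ⟨a, ha, -⟩ | ⟨p', hp', h⟩⟩ := ρ.of_sel_eq hj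
  · exact absurd ha (by simp [inputItem])
  have hmem : p'.2 ∈ ρ.syz ∪ Prod.snd '' ρ.basis := by
    rcases h with ⟨-, h⟩ | ⟨-, h⟩
    · exact .inl (ρ.H_subset_syz _ h)
    · exact .inr ⟨p', ρ.G_subset_basis _ h, rfl⟩
  have hs : sigMon (eps i : FreeBimod R k n r) = (⟨0, 1, i, 1⟩ : ModMon k n r) :=
    sigMon_single one_ne_zero
  have hsig : sig (modMul 1 1 1 p'.2) = Finsupp.single (⟨0, 1, i, 1⟩ : ModMon k n r) (1 : R) := by
    rw [one_modMul, hp'.sig_eq, inputItem, sig_of_sigMon_eq hs, eps, Finsupp.single_eq_same]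
  have := (IsSigTerm.of_sig_modMul_eq hM (Set.mem_insert_of_mem _ hmem) hsig).act
    ⟨μ.comm, μ.left⟩ μ.right 1
  rw [mul_one] at this
  convert this using 1
  subst hμ
  simp [ModMon.act]

/-- A skipped S-polynomial is covered already. Otherwise its reduction keeps the signature and stays
below the leading monomial of the ambiguity, so the result, in `G` or in `H`, is itself a cover. -/
theorem sel_sPol [IsDomain R] (hA : IsMonomialOrdering k n) (hM : IsModuleOrdering k n r) {j : ℕ}
    {p q : LPair R k n r} {a : Amb R k n r} (ha : a ∈ amb p q) (hr : a.IsRegular)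
    (hj : ρ.sel j = some (a.sPol, ItemType.S a)) :
    a.IsCovered (ρ.state (j + 1)).G (ρ.state (j + 1)).H := by
  obtain ⟨-, ⟨a', ha', hc⟩ | ⟨p', hp', h⟩⟩ := ρ.of_sel_eq hj
  · obtain rfl : a = a' := by simpa using ha'
    exact hc.mono (ρ.monotone_G j.le_succ) (ρ.monotone_H j.le_succ)
  have hsig : a.sig = SigGB.sig p'.2 := by
    rw [hp'.sig_eq, Amb.sig_sPol hM ha hr]
  rcases h with ⟨h0, h⟩ | ⟨h0, h⟩
  -- The syzygy alone carries the signature; the zero pair stands for the absent summand, with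
  -- leading monomial `⊥`.
  · refine ⟨0, Set.mem_insert _ _, p'.2, Set.mem_insert_of_mem _ h, 0, 1, 1, 1, 1, 1, ?_, ?_⟩
    · rw [zero_modMul, sig_zero, zero_add, one_modMul, hsig]
    · rw [zero_polyMul, LM_zero]
      exact bot_le.trans_lt (Amb.LM_sPol_lt hA ha)
  · refine ⟨p', Set.mem_insert_of_mem _ h, 0, Set.mem_insert _ _, 1, 0, 1, 1, 1, 1, ?_, ?_⟩
    · rw [zero_modMul, sig_zero, add_zero, one_modMul, hsig]
    · rw [one_polyMul]
      exact hp'.LM_le.trans_lt (Amb.LM_sPol_lt hA ha)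

/-- Either some regular reduction applies to the G-polynomial, or it enters the basis unchanged and
reduces itself. -/
theorem sel_gPol [IsDomain R] (hA : IsMonomialOrdering k n) {j : ℕ} {p q : LPair R k n r} {a : Amb R k n r}
    (ha : a ∈ amb p q) (hh : a.IsGPol (ρ.gPol a))
    (hj : ρ.sel j = some (ρ.gPol a, ItemType.G a)) : SigReducible ρ.basis (ρ.gPol a) := by
  obtain ⟨-, ⟨a', ha', -⟩ | ⟨p', hp', h⟩⟩ := ρ.of_sel_eq hj
  · exact absurd ha' (by simp)
  have hne := hh.ne_zero hA ha
  rcases hp'.eq_or_sigReducible with heq | hred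
  · change ρ.gPol a = p' at heq
    subst heq
    rcases h with ⟨h0, -⟩ | ⟨-, h⟩
    · exact absurd h0 hne
    · exact sigReducible_self (ρ.G_subset_basis _ h) hne
  · exact hred.mono (ρ.G_subset_basis _)

/-- All G-polynomials, and the S-polynomials of the regular ambiguities, of two labeled polynomials
in this order are in the queue at some time. -/
def Queued (ρ : Run F) (p q : LPair R k n r) : Prop :=
  ∀ a ∈ amb p q, (∃ j, (ρ.gPol a, ItemType.G a) ∈ (ρ.state j).P) ∧
    (a.IsRegular → ∃ j, (a.sPol, ItemType.S a) ∈ (ρ.state j).P)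

theorem queued_of_mem (j : ℕ) : ∀ p ∈ (ρ.state j).G, ∀ q ∈ (ρ.state j).G,
    ρ.Queued p q ∨ ρ.Queued q p := by
  induction j with
  | zero =>
    rw [ρ.state_zero]
    exact fun p hp => absurd hp (Set.notMem_empty p)
  | succ j ih =>
    rcases ρ.step j with ⟨x, -, -, ⟨-, hG, -⟩ | ⟨-, p', -, ⟨-, hG, -⟩ | ⟨-, hG, -, hP⟩⟩⟩ |
      ⟨-, -, hs⟩
    · rwa [hG]
    · rwa [hG]
    · have key : ∀ g ∈ (ρ.state (j + 1)).G, ρ.Queued p' g := by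
        intro g hg a ha
        refine ⟨⟨j + 1, ?_⟩, fun hr => ⟨j + 1, ?_⟩⟩
        · rw [hP]
          exact .inr ⟨g, hg, a, ha, .inr rfl⟩
        · rw [hP]
          exact .inr ⟨g, hg, a, ha, .inl ⟨hr, rfl⟩⟩
      intro p hp q hq
      rcases (hG ▸ hp : p ∈ insert p' (ρ.state j).G) with rfl | hp'
      · exact .inl (key q hq)
      rcases (hG ▸ hq : q ∈ insert p' (ρ.state j).G) with rfl | hq'
      · exact .inr (key p hp)
      · exact ih p hp' q hq'
    · rwa [hs]

theorem state_eq_of_P_eq_empty {j : ℕ} (hj : (ρ.state j).P = ∅) (l : ℕ) :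
    ρ.state (j + l) = ρ.state j := by
  induction l with
  | zero => rfl
  | succ l ih =>
    rcases ρ.step (j + l) with ⟨x, -, hx, -⟩ | ⟨-, -, hs⟩
    · rw [ih, hj] at hx
      exact absurd hx (Set.notMem_empty x)
    · rw [← add_assoc, hs, ih]

theorem basis_eq_of_P_eq_empty {j : ℕ} (hj : (ρ.state j).P = ∅) : ρ.basis = (ρ.state j).G := by
  refine (Set.iUnion_subset fun l => ?_).antisymm (ρ.G_subset_basis j)
  rw [← ρ.state_eq_of_P_eq_empty hj l]
  exact ρ.monotone_G (Nat.le_add_left l j)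

theorem syz_eq_of_P_eq_empty {j : ℕ} (hj : (ρ.state j).P = ∅) : ρ.syz = (ρ.state j).H := by
  refine (Set.iUnion_subset fun l => ?_).antisymm (ρ.H_subset_syz j)
  rw [← ρ.state_eq_of_P_eq_empty hj l]
  exact ρ.monotone_H (Nat.le_add_left l j)

end Run

end SigGB

end

/-! ### The limit of a fair run. -/

theorem mainTheorem2 {R : Type*} [CommRing R] [IsDomain R] [IsPrincipalIdealRing R] [GCDMonoid R]
    (k n r : ℕ) [LinearOrder (SigGB.Mon k n)] [LinearOrder (SigGB.ModMon k n r)]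
    (hA : SigGB.IsMonomialOrdering k n) (hM : SigGB.IsModuleOrdering k n r)
    (F : Fin r → SigGB.MixedAlg R k n) (ρ : SigGB.Run F) (hρ : ρ.IsFair) :
    -- the run enumerates a signature Gröbner basis and a syzygy basis
    SigGB.IsSigGroebnerBasis F ρ.basis ∧ SigGB.IsSyzygyBasis F ρ.syz ∧
    -- if it terminates, these are the returned sets
    (∀ j, (ρ.state j).P = ∅ →
      SigGB.IsSigGroebnerBasis F (ρ.state j).G ∧ SigGB.IsSyzygyBasis F (ρ.state j).H) ∧
    -- every generator is processed
    (∀ i, ∃ j, ρ.sel j = some (SigGB.inputItem F i)) ∧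
    -- the S-polynomials and G-polynomials of the ambiguities of the basis are processed
    (∀ p ∈ ρ.basis, ∀ q ∈ ρ.basis, ∃ p' q', (p' = p ∧ q' = q ∨ p' = q ∧ q' = p) ∧
      ∀ a ∈ SigGB.amb p' q',
        (∃ j, ρ.sel j = some (ρ.gPol a, SigGB.ItemType.G a)) ∧
        (a.IsRegular → ∃ j, ρ.sel j = some (a.sPol, SigGB.ItemType.S a))) ∧
    -- every regular ambiguity is covered after finitely many steps
    (∀ p ∈ ρ.basis, ∀ q ∈ ρ.basis, ∀ a ∈ SigGB.amb p q, a.IsRegular →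
      ∃ j, a.IsCovered (ρ.state j).G (ρ.state j).H) ∧
    -- the hypotheses of the cover criterion hold in the limit
    (∀ p ∈ ρ.basis, p.1 ≠ 0) ∧ SigGB.IsComplete ρ.basis ∧ SigGB.IsSigComplete ρ.syz ∧
    (∀ (μ : SigGB.ModMon k n r) (c : R), c ≠ 0 →
      SigGB.ModReducible (ρ.syz ∪ Prod.snd '' ρ.basis) (Finsupp.single μ c)) ∧
    (∀ p ∈ ρ.basis, ∀ q ∈ ρ.basis, ∀ a ∈ SigGB.amb p q, a.IsRegular →
      a.IsCovered ρ.basis ρ.syz) := by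

  have hinput : ∀ i, ∃ j, ρ.sel j = some (SigGB.inputItem F i) := by
    intro i
    refine hρ 0 _ ?_
    rw [ρ.state_zero]
    exact ⟨i, rfl⟩
  have hqueue : ∀ p q, ρ.Queued p q → ∀ a ∈ SigGB.amb p q,
      (∃ j, ρ.sel j = some (ρ.gPol a, SigGB.ItemType.G a)) ∧
      (a.IsRegular → ∃ j, ρ.sel j = some (a.sPol, SigGB.ItemType.S a)) := by
    intro p q h a ha
    obtain ⟨⟨i, hi⟩, h2⟩ := h a ha
    refine ⟨hρ i _ hi, fun hr => ?_⟩
    obtain ⟨j, hj⟩ := h2 hr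
    exact hρ j _ hj
  have hpair : ∀ p ∈ ρ.basis, ∀ q ∈ ρ.basis, ρ.Queued p q ∨ ρ.Queued q p := by
    intro p hp q hq
    obtain ⟨j, hpj, hqj⟩ := ρ.exists_mem_G hp hq
    exact ρ.queued_of_mem j p hpj q hqj
  have hcov : ∀ p ∈ ρ.basis, ∀ q ∈ ρ.basis, ∀ a ∈ SigGB.amb p q, a.IsRegular →
      ∃ j, a.IsCovered (ρ.state j).G (ρ.state j).H := by
    intro p hp q hq a ha hr
    rcases hpair p hp q hq with h | h
    · obtain ⟨j, hj⟩ := (hqueue p q h a ha).2 hr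
      exact ⟨j + 1, ρ.sel_sPol hA hM ha hr hj⟩
    -- Only the opposite order was queued: the flipped ambiguity becomes covered, and flipping back
    -- returns `a` by definition.
    · have ha' := SigGB.flip_mem_amb ha
      have hr' : a.flip.IsRegular := Ne.symm hr
      obtain ⟨j, hj⟩ := (hqueue q p h a.flip ha').2 hr'
      exact ⟨j + 1, (ρ.sel_sPol hA hM ha' hr' hj).flip hA hM ha' hr'⟩
  have hcov' : ∀ p ∈ ρ.basis, ∀ q ∈ ρ.basis, ∀ a ∈ SigGB.amb p q, a.IsRegular →
      a.IsCovered ρ.basis ρ.syz := by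
    intro p hp q hq a ha hr
    obtain ⟨j, hj⟩ := hcov p hp q hq a ha hr
    exact hj.mono (ρ.G_subset_basis j) (ρ.H_subset_syz j)
  have hterm : ∀ μ, SigGB.IsSigTerm (ρ.syz ∪ Prod.snd '' ρ.basis) μ (1 : R) := by
    intro μ
    obtain ⟨j, hj⟩ := hinput μ.idx
    exact ρ.sel_input hM hj μ rfl
  have hgpol : ∀ p ∈ ρ.basis, ∀ q ∈ ρ.basis, ρ.Queued p q →
      ∀ a ∈ SigGB.amb p q, ∃ h, a.IsGPol h ∧ SigGB.SigReducible ρ.basis h := by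
    intro p hp q hq h a ha
    have hh := ρ.isGPol p (ρ.basis_subset hp) q (ρ.basis_subset hq) a ha
    obtain ⟨j, hj⟩ := (hqueue p q h a ha).1
    exact ⟨ρ.gPol a, hh, ρ.sel_gPol hA ha hh hj⟩
  obtain ⟨hGB, hSyz⟩ := SigGB.isSigGroebnerBasis_and_isSyzygyBasis hA hM ρ.basis_subset
    (fun _ => ρ.basis_ne_zero) ρ.syz_subset ρ.isSigComplete_syz hterm
    (fun p hp q hq => (hpair p hp q hq).imp (hgpol p hp q hq) (hgpol q hq p hp)) hcov'
  refine ⟨hGB, hSyz, fun j hj => ?_, hinput, fun p hp q hq => ?_, hcov,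
    fun _ => ρ.basis_ne_zero, fun p hp q hq a ha h hh => ?_, ρ.isSigComplete_syz,
    fun μ c hc => ?_, hcov'⟩
  · rw [← ρ.basis_eq_of_P_eq_empty hj, ← ρ.syz_eq_of_P_eq_empty hj]
    exact ⟨hGB, hSyz⟩
  · rcases hpair p hp q hq with h | h
    · exact ⟨p, q, .inl ⟨rfl, rfl⟩, hqueue p q h⟩
    · exact ⟨q, p, .inr ⟨rfl, rfl⟩, hqueue q p h⟩
  -- Completeness concerns every choice of Bézout coefficients and both orders, whereas the run
  -- processes one choice in one order; it is recovered from the Gröbner basis property.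
  · exact hGB.2 h (hh.mem_labeledModule ha (ρ.basis_subset hp) (ρ.basis_subset hq))
      (hh.ne_zero hA ha)
  · rw [SigGB.modReducible_iff hM (SigGB.sigMon_single hc), Finsupp.single_eq_same]
    rcases hterm μ with h | ⟨γ, hγ, σ, m, b, hσ, hd, hμ⟩
    · exact absurd h one_ne_zero
    · exact .inr ⟨γ, hγ, σ, m, b, hσ, hd.trans (one_dvd c), hμ⟩
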